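/- Let $F$ be a diffeological space and let $\mathrm{Diff}(F)$ be the diffeological group of diffeomorphisms of $F$, in which a map $p:U\to\mathrm{Diff}(F)$ is a plot iff $(u,x)\mapsto p(u)(x)$ and $(u,x)\mapsto p(u)^{-1}(x)$ are smooth maps $U\times F\to F$. A smooth map $\pi:E\to B$ of diffeological spaces is trivial of fiber type $F$ if there is a diffeomorphism $E\cong B\times F$ over $B$; it is locally trivial if it is trivial over each member of some cover of $B$ by sets open in the $D$-topology; it is a diffeological bundle with fiber $F$ if its pullback along every plot of $B$ is locally trivial of fiber type $F$. For a diffeological group $G$ acting smoothly on the right on $E$ with $\pi(x\cdot g)=\pi(x)$, (locally) trivial principal $G$-bundles and principal $G$-bundles are defined in the same way, with $G$-equivariant diffeomorphisms to $B\times G$. A bundle (resp. principal $G$-bundle) over $B$ is $D$-numerable if there is a smooth partition of unity on $B$ subordinate to a $D$-open cover $\{B_i\}$ of $B$ over each member of which it is trivial (resp. trivial as a principal $G$-bundle). Let $\mathrm{Bun}_F(B)$ and $\mathrm{Bun}^D_F(B)$ (resp. $\mathrm{Prin}_G(B)$ and $\mathrm{Prin}^D_G(B)$) be the sets of isomorphism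 classes over $B$ of all and of all $D$-numerable diffeological bundles with fiber $F$ (resp. principal $G$-bundles, with $G$-equivariant isomorphisms). Pullback along smooth maps makes them contravariant in $B$. For a principal $\mathrm{Diff}(F)$-bundle $r:E\to B$, the associated bundle is $E\times_{\mathrm{Diff}(F)}F=(E\times F)/\!\sim\ \to B$, $[y,f]\mapsto r(y)$, with the quotient diffeology, where $(y,f)\sim(y\cdot g,g^{-1}(f))$ for $g\in\mathrm{Diff}(F)$. For a diffeological bundle $\pi:E\to B$ with fiber $F$, the frame bundle is $s:E'=\coprod_{b\in B}\mathrm{Diff}(\pi^{-1}(b),F)\to B$, where $\mathrm{Diff}(\pi^{-1}(b),F)$ is the set of diffeomorphisms $\pi^{-1}(b)\to F$, with the action $f\cdot g=g^{-1}\circ f$ of $\mathrm{Diff}(F)$; a map $p:U\to E'$ is a plot iff $s\circ p$ is smooth, $(u,y)\mapsto p(u)(y)$ is smooth from $\{(u,y)\in U\times E: s(p(u))=\pi(y)\}$ to $F$, and $(u,x)\mapsto p(u)^{-1}(x)$ is smooth from $U\times F$ to $E$. **Theorem.** For every diffeological space $B$ the associated bundle construction is a bijection $$\mathrm{assoc}:\mathrm{Prin}_{\mathrm{Diff}(F)}(B)\to\mathrm{Bun}_F(B),$$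 its inverse is given by the frame bundle construction, and it restricts to a bijection $\mathrm{Prin}^D_{\mathrm{Diff}(F)}(B)\to\mathrm{Bun}^D_F(B)$, with inverse again given by the frame bundle. The bijections are natural in $B$: for every smooth map $f:B'\to B$, pullback along $f$ preserves principal $\mathrm{Diff}(F)$-bundles, diffeological bundles with fiber $F$, and the $D$-numerable ones among them, and $\mathrm{assoc}(f^*c)=f^*(\mathrm{assoc}(c))$ for all $c\in\mathrm{Prin}_{\mathrm{Diff}(F)}(B)$. -/

import Mathlib

open Diffeology Topology

universe u v w w' u'

namespace DiffeologicalBundles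

/-! ### Diffeologies on subsets, products and quotients -/

section Constructions

variable {X : Type u} {Y : Type v} {Z : Type w}

/-- A map which near every point agrees with some plot is a plot. -/
theorem isPlot_of_locally [DiffeologicalSpace X] {n : ℕ} {p : EuclideanSpace ℝ (Fin n) → X}
    (h : ∀ x, ∃ q : EuclideanSpace ℝ (Fin n) → X, IsPlot q ∧ ∀ᶠ y in nhds x, p y = q y) :
    IsPlot p := by
  refine DiffeologicalSpace.locality fun x => ?_
  obtain ⟨q, hq, hpq⟩ := h x
  obtain ⟨u, hu, huo, hxu⟩ := eventually_nhds_iff.1 hpq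
  refine ⟨u, huo, hxu, fun {m f} hf hfs => ?_⟩
  have : p ∘ f = q ∘ f := funext fun z => hu _ (hf z)
  rw [this]
  exact isPlot_reparam hq hfs

/-- The diffeology on `X` whose plots are the maps that become plots of `Y` after composing
with `f`. -/
@[reducible] def inducedDiffeology [DiffeologicalSpace Y] (f : X → Y) : DiffeologicalSpace X where
  plots n := {p | IsPlot (f ∘ p)}
  constant_plots _ := isPlot_const
  plot_reparam hp hf := isPlot_reparam hp hf
  locality {n p} h := by
    refine DiffeologicalSpace.locality (p := f ∘ p) fun x => ?_
    obtain ⟨u, hu, hxu, h'⟩ := h x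
    exact ⟨u, hu, hxu, fun hf hfs => h' hf hfs⟩

/-- The sub-diffeology. -/
instance instSubtype [DiffeologicalSpace X] {P : X → Prop} : DiffeologicalSpace {x // P x} :=
  inducedDiffeology Subtype.val

/-- The product diffeology: a map is a plot iff both of its components are plots. -/
instance instProd [DiffeologicalSpace X] [DiffeologicalSpace Y] : DiffeologicalSpace (X × Y) :=
  inducedDiffeology Prod.fst ⊓ inducedDiffeology Prod.snd

theorem isPlot_subtype_iff [DiffeologicalSpace X] {P : X → Prop} {n : ℕ}
    {p : EuclideanSpace ℝ (Fin n) → {x // P x}} : IsPlot p ↔ IsPlot fun z => (p z).1 :=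
  Iff.rfl

theorem isPlot_prod_iff [DiffeologicalSpace X] [DiffeologicalSpace Y] {n : ℕ}
    {p : EuclideanSpace ℝ (Fin n) → X × Y} :
    IsPlot p ↔ (IsPlot fun z => (p z).1) ∧ IsPlot fun z => (p z).2 :=
  DiffeologicalSpace.isPlot_inf_iff

/-- Inside any neighbourhood of `x` there is the image of a smooth self-map of `ℝⁿ` that is the
identity near `x`. -/
theorem exists_smooth_retraction {n : ℕ} (x : EuclideanSpace ℝ (Fin n))
    {u : Set (EuclideanSpace ℝ (Fin n))} (hu : IsOpen u) (hx : x ∈ u) :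
    ∃ f : EuclideanSpace ℝ (Fin n) → EuclideanSpace ℝ (Fin n),
      ContDiff ℝ ((⊤ : ℕ∞) : WithTop ℕ∞) f ∧ (∀ z, f z ∈ u) ∧ ∀ᶠ z in nhds x, f z = z := by
  obtain ⟨ε, hε, hεu⟩ := Metric.isOpen_iff.1 hu x hx
  let χ : ContDiffBump x := ⟨ε / 2, ε, by positivity, by linarith⟩
  refine ⟨fun z => x + χ z • (z - x), ?_, fun z => hεu ?_, ?_⟩
  · exact contDiff_const.add (χ.contDiff.smul (contDiff_id.sub contDiff_const))
  · by_cases hz : z ∈ Metric.ball x ε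
    · rw [Metric.mem_ball, dist_eq_norm] at hz ⊢
      rw [add_sub_cancel_left, norm_smul, Real.norm_eq_abs, abs_of_nonneg χ.nonneg]
      exact (mul_le_of_le_one_left (norm_nonneg _) χ.le_one).trans_lt hz
    · have : χ z = 0 := by
        rw [← Function.notMem_support, χ.support_eq]
        exact hz
      simpa [this] using hε
  · filter_upwards [χ.eventuallyEq_one] with z hz
    rw [hz]
    simp

/-- The quotient diffeology: the plots are the maps which locally lift to plots of `X`. -/
instance instQuotient [DiffeologicalSpace X] (s : Setoid X) : DiffeologicalSpace (Quotient s) where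
  plots n := {p | ∀ x, ∃ q : EuclideanSpace ℝ (Fin n) → X,
    IsPlot q ∧ ∀ᶠ y in nhds x, p y = Quotient.mk s (q y)}
  constant_plots c := by
    obtain ⟨a, rfl⟩ := Quotient.exists_rep c
    exact fun _ => ⟨fun _ => a, isPlot_const, Filter.Eventually.of_forall fun _ => rfl⟩
  plot_reparam {n m p f} hp hf := fun x => by
    obtain ⟨q, hq, h⟩ := hp (f x)
    exact ⟨q ∘ f, isPlot_reparam hq hf, hf.continuous.continuousAt.eventually h⟩
  locality {n p} h := fun x => by
    obtain ⟨u, hu, hxu, h'⟩ := h x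
    obtain ⟨f, hf, hfu, hfx⟩ := exists_smooth_retraction x hu hxu
    obtain ⟨q, hq, hpq⟩ := h' hfu hf x
    refine ⟨q, hq, ?_⟩
    filter_upwards [hpq, hfx] with z hz hz'
    rw [← hz, Function.comp_apply, hz']

theorem dSmooth_quotient_mk [DiffeologicalSpace X] (s : Setoid X) :
    DSmooth (Quotient.mk s) :=
  fun _ p hp _ => ⟨p, hp, Filter.Eventually.of_forall fun _ => rfl⟩

theorem dSmooth_quotient_of_comp [DiffeologicalSpace X] [DiffeologicalSpace Y] {s : Setoid X}
    {f : Quotient s → Y} (h : DSmooth fun x => f (Quotient.mk s x)) : DSmooth f := by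
  intro n p hp
  refine isPlot_of_locally fun x => ?_
  obtain ⟨q, hq, hpq⟩ := hp x
  refine ⟨_, h n q hq, ?_⟩
  filter_upwards [hpq] with z hz
  simp [hz]

end Constructions

/-! ### Diffeomorphisms and the diffeological group `Diff(X)` -/

/-- Diffeomorphisms between diffeological spaces. -/
structure Diffeo (X : Type u) (Y : Type v) [DiffeologicalSpace X] [DiffeologicalSpace Y]
    extends X ≃ Y where
  smooth_toFun : DSmooth toFun
  smooth_invFun : DSmooth invFun

namespace Diffeo

variable {X : Type u} {Y : Type v} {Z : Type w}
  [DiffeologicalSpace X] [DiffeologicalSpace Y] [DiffeologicalSpace Z]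

instance : CoeFun (Diffeo X Y) fun _ => X → Y := ⟨fun f => f.toEquiv⟩

/-- The identity. -/
def refl (X : Type u) [DiffeologicalSpace X] : Diffeo X X :=
  ⟨Equiv.refl X, dSmooth_id, dSmooth_id⟩

/-- The inverse diffeomorphism. -/
def symm (f : Diffeo X Y) : Diffeo Y X := ⟨f.toEquiv.symm, f.smooth_invFun, f.smooth_toFun⟩

/-- First `f`, then `g`. -/
def trans (f : Diffeo X Y) (g : Diffeo Y Z) : Diffeo X Z :=
  ⟨f.toEquiv.trans g.toEquiv, g.smooth_toFun.comp f.smooth_toFun,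
    f.smooth_invFun.comp g.smooth_invFun⟩

theorem smooth (f : Diffeo X Y) : DSmooth f := f.smooth_toFun

@[ext] theorem ext {f g : Diffeo X Y} (h : ∀ x, f x = g x) : f = g := by
  obtain ⟨f, _, _⟩ := f
  obtain ⟨g, _, _⟩ := g
  obtain rfl : f = g := Equiv.ext h
  rfl

@[simp] theorem refl_apply (x : X) : refl X x = x := rfl
@[simp] theorem trans_apply (f : Diffeo X Y) (g : Diffeo Y Z) (x : X) : f.trans g x = g (f x) := rfl
@[simp] theorem symm_trans_apply (f : Diffeo X Y) (g : Diffeo Y Z) (z : Z) :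
    (f.trans g).symm z = f.symm (g.symm z) := rfl
@[simp] theorem symm_symm_apply (f : Diffeo X Y) (x : X) : f.symm.symm x = f x := rfl
@[simp] theorem symm_apply_apply (f : Diffeo X Y) (x : X) : f.symm (f x) = x :=
  f.toEquiv.symm_apply_apply x
@[simp] theorem apply_symm_apply (f : Diffeo X Y) (y : Y) : f (f.symm y) = y :=
  f.toEquiv.apply_symm_apply y

end Diffeo

/-- The group `Diff(F)` of diffeomorphisms `F → F`. -/
abbrev Diff (F : Type v) [DiffeologicalSpace F] : Type v := Diffeo F F

section DiffGroup

variable (F : Type v) [DiffeologicalSpace F]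

/-- The product `g * h` is the composite `g ∘ h`. -/
instance instGroupDiff : Group (Diff F) where
  mul g h := h.trans g
  one := Diffeo.refl F
  inv g := g.symm
  mul_assoc _ _ _ := rfl
  one_mul _ := rfl
  mul_one _ := rfl
  inv_mul_cancel g := Diffeo.ext fun x => g.symm_apply_apply x

/-- The natural left action of `Diff(F)` on `F`. -/
instance instMulActionDiff : MulAction (Diff F) F where
  smul g x := g x
  one_smul _ := rfl
  mul_smul _ _ _ := rfl

theorem diff_mul_apply (g h : Diff F) (x : F) : (g * h) x = g (h x) := rfl
theorem diff_inv_apply (g : Diff F) (x : F) : g⁻¹ x = g.symm x := rfl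

/-- The diffeology of `Diff(F)`: a map `p` into `Diff(F)` is a plot iff the maps
`(u, x) ↦ p(u)(x)` and `(u, x) ↦ p(u)⁻¹(x)` are smooth. -/
instance instDiffeologyDiff : DiffeologicalSpace (Diff F) where
  plots n := {p |
    (DSmooth fun z : EuclideanSpace ℝ (Fin n) × F => p z.1 z.2) ∧
    (DSmooth fun z : EuclideanSpace ℝ (Fin n) × F => (p z.1).symm z.2)}
  constant_plots g :=
    ⟨fun _ _ hq => g.smooth _ _ (isPlot_prod_iff.1 hq).2,
      fun _ _ hq => g.symm.smooth _ _ (isPlot_prod_iff.1 hq).2⟩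
  plot_reparam {n m p f} hp hf := by
    have key : ∀ k (q : EuclideanSpace ℝ (Fin k) → EuclideanSpace ℝ (Fin n) × F), IsPlot q →
        IsPlot fun z => (f (q z).1, (q z).2) := fun k q hq =>
      isPlot_prod_iff.2 ⟨hf.dSmooth _ _ (isPlot_prod_iff.1 hq).1, (isPlot_prod_iff.1 hq).2⟩
    exact ⟨fun k q hq => hp.1 k _ (key k q hq), fun k q hq => hp.2 k _ (key k q hq)⟩
  locality {n p} h := by
    have key : ∀ k (q : EuclideanSpace ℝ (Fin k) → EuclideanSpace ℝ (Fin n) × F), IsPlot q →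
        ∀ x, ∃ v : Set (EuclideanSpace ℝ (Fin k)), IsOpen v ∧ x ∈ v ∧
          ∀ {m : ℕ} {f : EuclideanSpace ℝ (Fin m) → EuclideanSpace ℝ (Fin k)}, (∀ z, f z ∈ v) →
            ContDiff ℝ ((⊤ : ℕ∞) : WithTop ℕ∞) f →
            (IsPlot fun z => p (q (f z)).1 (q (f z)).2) ∧
            (IsPlot fun z => (p (q (f z)).1).symm (q (f z)).2) := by
      intro k q hq x
      obtain ⟨hq1, hq2⟩ := isPlot_prod_iff.1 hq
      obtain ⟨u, hu, hxu, hp⟩ := h (q x).1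
      refine ⟨(fun z => (q z).1) ⁻¹' u, hu.preimage hq1.contDiff.continuous, hxu, ?_⟩
      intro m f hf hfs
      have hpf := hp (f := fun z => (q (f z)).1) hf (hq1.contDiff.comp hfs)
      have hpair : IsPlot fun z => (z, (q (f z)).2) :=
        isPlot_prod_iff.2 ⟨isPlot_id', isPlot_reparam hq2 hfs⟩
      exact ⟨hpf.1 m _ hpair, hpf.2 m _ hpair⟩
    refine ⟨fun k q hq => DiffeologicalSpace.locality fun x => ?_,
      fun k q hq => DiffeologicalSpace.locality fun x => ?_⟩
    · obtain ⟨v, hv, hxv, hv'⟩ := key k q hq x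
      exact ⟨v, hv, hxv, fun hf hfs => (hv' hf hfs).1⟩
    · obtain ⟨v, hv, hxv, hv'⟩ := key k q hq x
      exact ⟨v, hv, hxv, fun hf hfs => (hv' hf hfs).2⟩

/-- Diffeological groups: the group operations are smooth. -/
class DiffeologicalGroup (G : Type v) [Group G] [DiffeologicalSpace G] : Prop where
  smooth_mul : DSmooth fun z : G × G => z.1 * z.2
  smooth_inv : DSmooth fun g : G => g⁻¹

instance instDiffeologicalGroupDiff : DiffeologicalGroup (Diff F) where
  smooth_mul n p hp := by
    obtain ⟨h1, h2⟩ := isPlot_prod_iff.1 hp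
    refine ⟨fun k q hq => ?_, fun k q hq => ?_⟩
    · obtain ⟨hq1, hq2⟩ := isPlot_prod_iff.1 hq
      exact h1.1 k (fun z => ((q z).1, (p (q z).1).2 (q z).2))
        (isPlot_prod_iff.2 ⟨hq1, h2.1 k q hq⟩)
    · obtain ⟨hq1, hq2⟩ := isPlot_prod_iff.1 hq
      exact h2.2 k (fun z => ((q z).1, (p (q z).1).1.symm (q z).2))
        (isPlot_prod_iff.2 ⟨hq1, h1.2 k q hq⟩)
  smooth_inv n p hp := ⟨hp.2, hp.1⟩

end DiffGroup

/-! ### Spaces over a base and diffeological bundles -/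

/-- A diffeological space `total` with a smooth map `proj` to `B`. -/
structure SpaceOver (B : Type u) [DiffeologicalSpace B] where
  total : Type w
  [diffeology : DiffeologicalSpace total]
  proj : total → B
  smooth_proj : DSmooth proj

attribute [instance] SpaceOver.diffeology

namespace SpaceOver

variable {B : Type u} [DiffeologicalSpace B]

/-- Isomorphism over `B`: a diffeomorphism of total spaces commuting with the projections. -/
def Iso (E : SpaceOver.{u, w} B) (E' : SpaceOver.{u, w'} B) : Prop :=
  ∃ h : Diffeo E.total E'.total, ∀ e, E'.proj (h e) = E.proj e

/-- The restriction `π⁻¹(U) → U`. -/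
def restrict (E : SpaceOver.{u, w} B) (U : Set B) : SpaceOver.{u, w} {b // b ∈ U} where
  total := {e : E.total // E.proj e ∈ U}
  proj e := ⟨E.proj e.1, e.2⟩
  smooth_proj _ _ hp := E.smooth_proj _ _ hp

/-- The pullback `B' ×_B E → B'` along `f : B' → B`. -/
def pullback {B' : Type u'} [DiffeologicalSpace B'] (f : B' → B) (E : SpaceOver.{u, w} B) :
    SpaceOver.{u', max u' w} B' where
  total := {z : B' × E.total // f z.1 = E.proj z.2}
  proj z := z.1.1
  smooth_proj _ _ hp := (isPlot_prod_iff.1 hp).1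

/-- Triviality of fiber type `F`. -/
def IsTrivial (F : Type v) [DiffeologicalSpace F] (E : SpaceOver.{u, w} B) : Prop :=
  ∃ h : Diffeo E.total (B × F), ∀ e, (h e).1 = E.proj e

/-- Local triviality of fiber type `F`, over a `D`-open cover. -/
def IsLocallyTrivial (F : Type v) [DiffeologicalSpace F] (E : SpaceOver.{u, w} B) : Prop :=
  ∃ 𝒰 : Set (Set B), (∀ U ∈ 𝒰, IsOpen[dTopology] U) ∧ ⋃₀ 𝒰 = Set.univ ∧
    ∀ U ∈ 𝒰, (E.restrict U).IsTrivial F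

/-- Diffeological bundles of fiber type `F`: the pullback along every plot of the base is locally
trivial of fiber type `F`. -/
def IsBundle (F : Type v) [DiffeologicalSpace F] (E : SpaceOver.{u, w} B) : Prop :=
  ∀ (n : ℕ) (p : EuclideanSpace ℝ (Fin n) → B), IsPlot p → (E.pullback p).IsLocallyTrivial F

end SpaceOver

/-! ### Principal bundles -/

/-- A diffeological space over `B` with a smooth right action of `G` preserving the fibers. Right
actions of `G` are actions of `Gᵐᵒᵖ`, and `x · g` is `MulOpposite.op g • x`. -/
structure GSpaceOver (G : Type v) [Group G] [DiffeologicalSpace G]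
    (B : Type u) [DiffeologicalSpace B] extends SpaceOver.{u, w} B where
  [action : MulAction Gᵐᵒᵖ total]
  smooth_action : DSmooth fun z : total × G => MulOpposite.op z.2 • z.1
  proj_smul : ∀ (g : G) (e : total), proj (MulOpposite.op g • e) = proj e

attribute [instance] GSpaceOver.action

namespace GSpaceOver

variable {G : Type v} [Group G] [DiffeologicalSpace G] {B : Type u} [DiffeologicalSpace B]

/-- Isomorphism over `B`: a `G`-equivariant diffeomorphism of total spaces commuting with the
projections. -/
def Iso (P : GSpaceOver.{u, v, w} G B) (P' : GSpaceOver.{u, v, w'} G B) : Prop :=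
  ∃ h : Diffeo P.total P'.total, (∀ e, P'.proj (h e) = P.proj e) ∧
    ∀ (g : G) (e : P.total), h (MulOpposite.op g • e) = MulOpposite.op g • h e

/-- The restriction `π⁻¹(U) → U`, with the restricted action. -/
def restrict (P : GSpaceOver.{u, v, w} G B) (U : Set B) : GSpaceOver.{u, v, w} G {b // b ∈ U} where
  toSpaceOver := P.toSpaceOver.restrict U
  action :=
    { smul := fun g e => ⟨g • e.1, by
        have h : P.proj (g • e.1) = P.proj e.1 := P.proj_smul g.unop e.1
        rw [h]
        exact e.2⟩
      one_smul := fun e => Subtype.ext (one_smul _ e.1)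
      mul_smul := fun g h e => Subtype.ext (mul_smul g h e.1) }
  smooth_action n p hp := P.smooth_action n (fun z => ((p z).1.1, (p z).2)) hp
  proj_smul g e := Subtype.ext (P.proj_smul g e.1)

/-- The pullback along `f : B' → B`, with `G` acting on the second component. -/
def pullback {B' : Type u'} [DiffeologicalSpace B'] (f : B' → B) (P : GSpaceOver.{u, v, w} G B) :
    GSpaceOver.{u', v, max u' w} G B' where
  toSpaceOver := P.toSpaceOver.pullback f
  action :=
    { smul := fun g z => ⟨(z.1.1, g • z.1.2), by
        have h : P.proj (g • z.1.2) = P.proj z.1.2 := P.proj_smul g.unop z.1.2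
        exact z.2.trans h.symm⟩
      one_smul := fun z => Subtype.ext (Prod.ext rfl (one_smul _ z.1.2))
      mul_smul := fun g h z => Subtype.ext (Prod.ext rfl (mul_smul g h z.1.2)) }
  smooth_action n p hp := by
    obtain ⟨h1, h2⟩ := isPlot_prod_iff.1 hp
    obtain ⟨h3, h4⟩ := isPlot_prod_iff.1 (isPlot_subtype_iff.1 h1)
    exact isPlot_subtype_iff.2 (isPlot_prod_iff.2
      ⟨h3, P.smooth_action n (fun z => ((p z).1.1.2, (p z).2)) (isPlot_prod_iff.2 ⟨h4, h2⟩)⟩)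
  proj_smul _ _ := rfl

/-- Trivial principal bundles: equivariantly isomorphic to `B × G` with
`(b, g) · g' = (b, g g')`. -/
def IsTrivial (P : GSpaceOver.{u, v, w} G B) : Prop :=
  ∃ h : Diffeo P.total (B × G), (∀ e, (h e).1 = P.proj e) ∧
    ∀ (g : G) (e : P.total), h (MulOpposite.op g • e) = ((h e).1, (h e).2 * g)

/-- Locally trivial principal bundles. -/
def IsLocallyTrivial (P : GSpaceOver.{u, v, w} G B) : Prop :=
  ∃ 𝒰 : Set (Set B), (∀ U ∈ 𝒰, IsOpen[dTopology] U) ∧ ⋃₀ 𝒰 = Set.univ ∧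
    ∀ U ∈ 𝒰, (P.restrict U).IsTrivial

/-- Principal `G`-bundles: the pullback along every plot of the base is a locally trivial principal
bundle. -/
def IsPrincipal (P : GSpaceOver.{u, v, w} G B) : Prop :=
  ∀ (n : ℕ) (p : EuclideanSpace ℝ (Fin n) → B), IsPlot p → (P.pullback p).IsLocallyTrivial

end GSpaceOver

/-! ### Partitions of unity and `D`-numerable bundles -/

/-- The support of a nonnegative function: the closure of `{μ > 0}` in the `D`-topology. -/
def dSupport {X : Type u} [DiffeologicalSpace X] (μ : X → ℝ) : Set X :=
  @closure X dTopology (μ ⁻¹' Set.Ioi 0)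

/-- Smooth partitions of unity on a diffeological space. -/
structure IsSmoothPartitionOfUnity {X : Type u} [DiffeologicalSpace X] {ι : Type w}
    (μ : ι → X → ℝ) : Prop where
  smooth : ∀ i, DSmooth (μ i)
  nonneg : ∀ i x, 0 ≤ μ i x
  locallyFinite : @LocallyFinite ι X dTopology fun i => dSupport (μ i)
  sum_eq_one : ∀ x, ∑ᶠ i, μ i x = 1

/-- A `D`-open cover admitting a subordinate smooth partition of unity. -/
structure IsDNumerableCover {X : Type u} [DiffeologicalSpace X] {ι : Type w}
    (U : ι → Set X) : Prop where
  isOpen : ∀ i, IsOpen[dTopology] (U i)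
  cover : ⋃ i, U i = Set.univ
  exists_partition : ∃ μ : ι → X → ℝ, IsSmoothPartitionOfUnity μ ∧ ∀ i, dSupport (μ i) ⊆ U i

/-- `D`-numerable bundles of fiber type `F`. -/
def SpaceOver.IsDNumerable {B : Type u} [DiffeologicalSpace B] (F : Type v) [DiffeologicalSpace F]
    (E : SpaceOver.{u, w} B) : Prop :=
  ∃ (ι : Type u) (U : ι → Set B), IsDNumerableCover U ∧ ∀ i, (E.restrict (U i)).IsTrivial F

/-- `D`-numerable principal `G`-bundles. -/
def GSpaceOver.IsDNumerable {G : Type v} [Group G] [DiffeologicalSpace G] {B : Type u}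
    [DiffeologicalSpace B] (P : GSpaceOver.{u, v, w} G B) : Prop :=
  ∃ (ι : Type u) (U : ι → Set B), IsDNumerableCover U ∧ ∀ i, (P.restrict (U i)).IsTrivial

/-! ### The associated bundle -/

section Assoc

variable {G : Type v} [Group G] [DiffeologicalSpace G] {B : Type u} [DiffeologicalSpace B]
  (F : Type w') [DiffeologicalSpace F] [MulAction G F]

/-- The relation `(y, f) ∼ (y · g, g⁻¹ · f)` on `P × F`. -/
def assocSetoid (P : GSpaceOver.{u, v, w} G B) : Setoid (P.total × F) where
  r z z' := ∃ g : G, z' = (MulOpposite.op g • z.1, g⁻¹ • z.2)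
  iseqv :=
    { refl := fun z => ⟨1, by simp⟩
      symm := by
        rintro z _ ⟨g, rfl⟩
        refine ⟨g⁻¹, ?_⟩
        simp
      trans := by
        rintro z _ _ ⟨g, rfl⟩ ⟨h, rfl⟩
        exact ⟨g * h, by simp [mul_smul]⟩ }

/-- The associated bundle `P ×_G F → B`, `[y, f] ↦ π(y)`, with the quotient diffeology. -/
def GSpaceOver.assoc (P : GSpaceOver.{u, v, w} G B) : SpaceOver.{u, max w w'} B where
  total := Quotient (assocSetoid F P)
  proj := Quotient.lift (fun z : P.total × F => P.proj z.1) (by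
    rintro z _ ⟨g, rfl⟩
    exact (P.proj_smul g z.1).symm)
  smooth_proj := dSmooth_quotient_of_comp fun n p hp =>
    P.smooth_proj n _ (isPlot_prod_iff.1 hp).1

end Assoc

/-! ### The frame bundle -/

section Frame

variable (F : Type v) [DiffeologicalSpace F] {B : Type u} [DiffeologicalSpace B]

/-- The fiber `π⁻¹(b)`, with the sub-diffeology. -/
abbrev SpaceOver.Fiber (E : SpaceOver.{u, w} B) (b : B) : Type w := {e : E.total // E.proj e = b}

/-- The set `∐_{b ∈ B} Diff(E_b, F)`. -/
structure SpaceOver.FrameTotal (E : SpaceOver.{u, w} B) : Type (max u v w) where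
  base : B
  map : Diffeo (E.Fiber base) F

variable {F}

/-- The conditions for a map `p` into `∐_b Diff(E_b, F)` to be a plot: its base point varies
smoothly, and `(u, y) ↦ p(u)(y)` and `(u, x) ↦ p(u)⁻¹(x)` are smooth where defined. -/
structure SpaceOver.IsFramePlot (E : SpaceOver.{u, w} B) {n : ℕ}
    (p : EuclideanSpace ℝ (Fin n) → E.FrameTotal F) : Prop where
  base : IsPlot fun t => (p t).base
  eval : DSmooth fun z : {z : EuclideanSpace ℝ (Fin n) × E.total // E.proj z.2 = (p z.1).base} =>
    (p z.1.1).map ⟨z.1.2, z.2⟩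
  inv : DSmooth fun z : EuclideanSpace ℝ (Fin n) × F => ((p z.1).map.symm z.2).1

theorem SpaceOver.IsFramePlot.reparam {E : SpaceOver.{u, w} B} {n m : ℕ}
    {p : EuclideanSpace ℝ (Fin m) → E.FrameTotal F} (hp : E.IsFramePlot p)
    {f : EuclideanSpace ℝ (Fin n) → EuclideanSpace ℝ (Fin m)}
    (hf : ContDiff ℝ ((⊤ : ℕ∞) : WithTop ℕ∞) f) : E.IsFramePlot (p ∘ f) where
  base := isPlot_reparam hp.base hf
  eval k q hq := by
    obtain ⟨h1, h2⟩ := isPlot_prod_iff.1 (isPlot_subtype_iff.1 hq)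
    exact hp.eval k (fun z => ⟨(f (q z).1.1, (q z).1.2), (q z).2⟩)
      (isPlot_subtype_iff.2 (isPlot_prod_iff.2 ⟨hf.dSmooth _ _ h1, h2⟩))
  inv k q hq := by
    obtain ⟨h1, h2⟩ := isPlot_prod_iff.1 hq
    exact hp.inv k (fun z => (f (q z).1, (q z).2))
      (isPlot_prod_iff.2 ⟨hf.dSmooth _ _ h1, h2⟩)

instance instDiffeologyFrame (E : SpaceOver.{u, w} B) :
    DiffeologicalSpace (E.FrameTotal F) where
  plots n := {p | E.IsFramePlot p}
  constant_plots c :=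
    { base := isPlot_const
      eval := fun k q hq => c.map.smooth k (fun z => ⟨(q z).1.2, (q z).2⟩)
        (isPlot_prod_iff.1 (isPlot_subtype_iff.1 hq)).2
      inv := fun k q hq => isPlot_subtype_iff.1
        (c.map.symm.smooth k (fun z => (q z).2) (isPlot_prod_iff.1 hq).2) }
  plot_reparam hp hf := SpaceOver.IsFramePlot.reparam hp hf
  locality {n p} h :=
    { base := DiffeologicalSpace.locality fun x => by
        obtain ⟨u, hu, hxu, hp⟩ := h x
        exact ⟨u, hu, hxu, fun hf hfs => (hp hf hfs).base⟩
      eval := fun k q hq => DiffeologicalSpace.locality fun x => by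
        obtain ⟨h1, h2⟩ := isPlot_prod_iff.1 (isPlot_subtype_iff.1 hq)
        obtain ⟨u, hu, hxu, hp⟩ := h (q x).1.1
        refine ⟨(fun z => (q z).1.1) ⁻¹' u, hu.preimage h1.contDiff.continuous, hxu, ?_⟩
        intro m f hf hfs
        exact (hp (f := fun z => (q (f z)).1.1) hf (h1.contDiff.comp hfs)).eval m
          (fun z => ⟨(z, (q (f z)).1.2), (q (f z)).2⟩)
          (isPlot_subtype_iff.2 (isPlot_prod_iff.2 ⟨isPlot_id', isPlot_reparam h2 hfs⟩))
      inv := fun k q hq => DiffeologicalSpace.locality fun x => by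
        obtain ⟨h1, h2⟩ := isPlot_prod_iff.1 hq
        obtain ⟨u, hu, hxu, hp⟩ := h (q x).1
        refine ⟨(fun z => (q z).1) ⁻¹' u, hu.preimage h1.contDiff.continuous, hxu, ?_⟩
        intro m f hf hfs
        exact (hp (f := fun z => (q (f z)).1) hf (h1.contDiff.comp hfs)).inv m
          (fun z => (z, (q (f z)).2))
          (isPlot_prod_iff.2 ⟨isPlot_id', isPlot_reparam h2 hfs⟩) }

variable (F)

/-- The frame bundle `∐_b Diff(E_b, F) → B`, with the right action `f · g = g⁻¹ ∘ f` of
`Diff(F)`. -/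
def SpaceOver.frame (E : SpaceOver.{u, w} B) : GSpaceOver.{u, v, max u v w} (Diff F) B where
  total := E.FrameTotal F
  proj x := x.base
  smooth_proj _ _ hp := SpaceOver.IsFramePlot.base hp
  action :=
    { smul := fun g x => ⟨x.base, x.map.trans (g.unop)⁻¹⟩
      one_smul := fun _ => rfl
      mul_smul := fun _ _ _ => rfl }
  smooth_action n p hp := by
    obtain ⟨h1', h2⟩ := isPlot_prod_iff.1 hp
    have h1 : E.IsFramePlot fun z => (p z).1 := h1'
    exact
      { base := h1.base
        eval := fun k q hq => by
          obtain ⟨h3, h4⟩ := isPlot_prod_iff.1 (isPlot_subtype_iff.1 hq)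
          exact h2.2 k (fun z => ((q z).1.1, (p (q z).1.1).1.map ⟨(q z).1.2, (q z).2⟩))
            (isPlot_prod_iff.2 ⟨h3, h1.eval k q hq⟩)
        inv := fun k q hq => by
          obtain ⟨h3, h4⟩ := isPlot_prod_iff.1 hq
          exact h1.inv k (fun z => ((q z).1, (p (q z).1).2 (q z).2))
            (isPlot_prod_iff.2 ⟨h3, h2.1 k q hq⟩) }
  proj_smul _ _ := rfl

end Frame

/-! ### Isomorphism classes -/

section Classes

theorem SpaceOver.iso_equivalence (B : Type u) [DiffeologicalSpace B] :
    Equivalence (fun E E' : SpaceOver.{u, w} B => E.Iso E') where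
  refl E := ⟨Diffeo.refl _, fun _ => rfl⟩
  symm := by
    rintro E E' ⟨h, hh⟩
    exact ⟨h.symm, fun e => by rw [← hh, h.apply_symm_apply]⟩
  trans := by
    rintro E E' E'' ⟨h, hh⟩ ⟨k, hk⟩
    exact ⟨h.trans k, fun e => (hk _).trans (hh e)⟩

theorem GSpaceOver.iso_equivalence (G : Type v) [Group G] [DiffeologicalSpace G]
    (B : Type u) [DiffeologicalSpace B] :
    Equivalence (fun P P' : GSpaceOver.{u, v, w} G B => P.Iso P') where
  refl E := ⟨Diffeo.refl _, fun _ => rfl, fun _ _ => rfl⟩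
  symm := by
    rintro E E' ⟨h, hh, hg⟩
    refine ⟨h.symm, fun e => by rw [← hh, h.apply_symm_apply], fun g e => ?_⟩
    conv_lhs => rw [← h.apply_symm_apply e, ← hg, h.symm_apply_apply]
  trans := by
    rintro E E' E'' ⟨h, hh, hg⟩ ⟨k, hk, hg'⟩
    exact ⟨h.trans k, fun e => (hk _).trans (hh e), fun g e => by simp [hg, hg']⟩

/-- Isomorphism classes of spaces over `B`. -/
def SpaceOverClass (B : Type u) [DiffeologicalSpace B] : Type (max u (w + 1)) :=
  Quotient (⟨_, SpaceOver.iso_equivalence.{u, w} B⟩ : Setoid (SpaceOver.{u, w} B))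

/-- Isomorphism classes of spaces over `B` with a fiberwise smooth right `G`-action. -/
def GSpaceOverClass (G : Type v) [Group G] [DiffeologicalSpace G]
    (B : Type u) [DiffeologicalSpace B] : Type (max u v (w + 1)) :=
  Quotient (⟨_, GSpaceOver.iso_equivalence.{u, v, w} G B⟩ : Setoid (GSpaceOver.{u, v, w} G B))

variable {B : Type u} [DiffeologicalSpace B]

/-- The isomorphism class of a space over `B`. -/
def SpaceOver.toClass (E : SpaceOver.{u, w} B) : SpaceOverClass.{u, w} B := Quotient.mk _ E

/-- The isomorphism class of a `G`-space over `B`. -/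
def GSpaceOver.toClass {G : Type v} [Group G] [DiffeologicalSpace G]
    (P : GSpaceOver.{u, v, w} G B) : GSpaceOverClass.{u, v, w} G B := Quotient.mk _ P

theorem SpaceOver.Iso.pullback {B' : Type u'} [DiffeologicalSpace B'] (f : B' → B)
    {E E' : SpaceOver.{u, w} B} (H : E.Iso E') : (E.pullback f).Iso (E'.pullback f) := by
  obtain ⟨h, hh⟩ := H
  have hs : ∀ e, E.proj (h.symm e) = E'.proj e := fun e => by rw [← hh, h.apply_symm_apply]
  refine ⟨⟨⟨fun z => ⟨(z.1.1, h z.1.2), z.2.trans (hh _).symm⟩,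
    fun z => ⟨(z.1.1, h.symm z.1.2), z.2.trans (hs _).symm⟩, ?_, ?_⟩, ?_, ?_⟩, fun _ => rfl⟩
  · exact fun z => Subtype.ext (Prod.ext rfl (h.symm_apply_apply _))
  · exact fun z => Subtype.ext (Prod.ext rfl (h.apply_symm_apply _))
  · intro n p hp
    obtain ⟨h1, h2⟩ := isPlot_prod_iff.1 (isPlot_subtype_iff.1 hp)
    exact isPlot_subtype_iff.2 (isPlot_prod_iff.2 ⟨h1, h.smooth _ _ h2⟩)
  · intro n p hp
    obtain ⟨h1, h2⟩ := isPlot_prod_iff.1 (isPlot_subtype_iff.1 hp)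
    exact isPlot_subtype_iff.2 (isPlot_prod_iff.2 ⟨h1, h.symm.smooth _ _ h2⟩)

theorem GSpaceOver.Iso.pullback {B' : Type u'} [DiffeologicalSpace B'] (f : B' → B)
    {G : Type v} [Group G] [DiffeologicalSpace G]
    {P P' : GSpaceOver.{u, v, w} G B} (H : P.Iso P') : (P.pullback f).Iso (P'.pullback f) := by
  obtain ⟨h, hh, hg⟩ := H
  have hs : ∀ e, P.proj (h.symm e) = P'.proj e := fun e => by rw [← hh, h.apply_symm_apply]
  refine ⟨⟨⟨fun z => ⟨(z.1.1, h z.1.2), z.2.trans (hh _).symm⟩,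
    fun z => ⟨(z.1.1, h.symm z.1.2), z.2.trans (hs _).symm⟩, ?_, ?_⟩, ?_, ?_⟩, fun _ => rfl, ?_⟩
  · exact fun z => Subtype.ext (Prod.ext rfl (h.symm_apply_apply _))
  · exact fun z => Subtype.ext (Prod.ext rfl (h.apply_symm_apply _))
  · intro n p hp
    obtain ⟨h1, h2⟩ := isPlot_prod_iff.1 (isPlot_subtype_iff.1 hp)
    exact isPlot_subtype_iff.2 (isPlot_prod_iff.2 ⟨h1, h.smooth _ _ h2⟩)
  · intro n p hp
    obtain ⟨h1, h2⟩ := isPlot_prod_iff.1 (isPlot_subtype_iff.1 hp)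
    exact isPlot_subtype_iff.2 (isPlot_prod_iff.2 ⟨h1, h.symm.smooth _ _ h2⟩)
  · exact fun g z => Subtype.ext (Prod.ext rfl (hg g z.1.2))

theorem GSpaceOver.Iso.assoc {G : Type v} [Group G] [DiffeologicalSpace G]
    (F : Type w') [DiffeologicalSpace F] [MulAction G F]
    {P P' : GSpaceOver.{u, v, w} G B} (H : P.Iso P') : (P.assoc F).Iso (P'.assoc F) := by
  have aux : ∀ {P P' : GSpaceOver.{u, v, w} G B} (h : Diffeo P.total P'.total)
      (_ : ∀ (g : G) (e : P.total), h (MulOpposite.op g • e) = MulOpposite.op g • h e),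
      ∃ k : (P.assoc F).total → (P'.assoc F).total, DSmooth k ∧
        ∀ z : P.total × F, k (Quotient.mk (assocSetoid F P) z) =
          Quotient.mk (assocSetoid F P') (h z.1, z.2) := by
    intro P P' h hg
    refine ⟨Quotient.lift (fun z : P.total × F => Quotient.mk (assocSetoid F P') (h z.1, z.2)) ?_,
      ?_, fun z => rfl⟩
    · rintro z _ ⟨g, rfl⟩
      exact Quotient.sound ⟨g, by simp [hg]⟩
    · refine dSmooth_quotient_of_comp fun n p hp => dSmooth_quotient_mk _ n _ ?_
      obtain ⟨h1, h2⟩ := isPlot_prod_iff.1 hp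
      exact isPlot_prod_iff.2 ⟨h.smooth _ _ h1, h2⟩
  obtain ⟨h, hh, hg⟩ := H
  obtain ⟨k, hks, hk⟩ := aux h hg
  obtain ⟨l, hls, hl⟩ := aux h.symm (fun g e => by
    conv_lhs => rw [← h.apply_symm_apply e, ← hg, h.symm_apply_apply])
  refine ⟨⟨⟨k, l, fun z => ?_, fun z => ?_⟩, hks, hls⟩, fun z => ?_⟩
  · induction z using Quotient.inductionOn with
    | h z => rw [hk, hl, h.symm_apply_apply]
  · induction z using Quotient.inductionOn with
    | h z => rw [hl, hk, h.apply_symm_apply]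
  · induction z using Quotient.inductionOn with
    | h z =>
      change (P'.assoc F).proj (k _) = _
      rw [hk]
      exact hh z.1

/-- The diffeomorphism of fibers given by an isomorphism over `B`. -/
def fiberDiffeo {E E' : SpaceOver.{u, w} B} (h : Diffeo E.total E'.total)
    (hh : ∀ e, E'.proj (h e) = E.proj e) (b : B) : Diffeo (E.Fiber b) (E'.Fiber b) where
  toFun e := ⟨h e.1, (hh _).trans e.2⟩
  invFun e := ⟨h.symm e.1, by rw [← hh, h.apply_symm_apply]; exact e.2⟩
  left_inv e := Subtype.ext (h.symm_apply_apply _)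
  right_inv e := Subtype.ext (h.apply_symm_apply _)
  smooth_toFun n p hp := isPlot_subtype_iff.2 (h.smooth n _ (isPlot_subtype_iff.1 hp))
  smooth_invFun n p hp := isPlot_subtype_iff.2 (h.symm.smooth n _ (isPlot_subtype_iff.1 hp))

theorem SpaceOver.Iso.frame (F : Type v) [DiffeologicalSpace F]
    {E E' : SpaceOver.{u, w} B} (H : E.Iso E') : (E.frame F).Iso (E'.frame F) := by
  have aux : ∀ {E E' : SpaceOver.{u, w} B} (h : Diffeo E.total E'.total)
      (hh : ∀ e, E'.proj (h e) = E.proj e),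
      DSmooth fun x : E.FrameTotal F =>
        (⟨x.base, (fiberDiffeo h hh x.base).symm.trans x.map⟩ : E'.FrameTotal F) := by
    intro E E' h hh n p hp
    have hp' : E.IsFramePlot p := hp
    exact
      { base := hp'.base
        eval := fun k q hq => by
          obtain ⟨h1, h2⟩ := isPlot_prod_iff.1 (isPlot_subtype_iff.1 hq)
          exact hp'.eval k (fun z => ⟨((q z).1.1, h.symm (q z).1.2), by
              rw [← hh, h.apply_symm_apply]
              exact (q z).2⟩)
            (isPlot_subtype_iff.2 (isPlot_prod_iff.2 ⟨h1, h.symm.smooth _ _ h2⟩))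
        inv := fun k q hq => h.smooth _ _ (hp'.inv k q hq) }
  obtain ⟨h, hh⟩ := H
  have hs : ∀ e, E.proj (h.symm e) = E'.proj e := fun e => by rw [← hh, h.apply_symm_apply]
  refine ⟨⟨⟨fun x => ⟨x.base, (fiberDiffeo h hh x.base).symm.trans x.map⟩,
    fun x => ⟨x.base, (fiberDiffeo h.symm hs x.base).symm.trans x.map⟩, ?_, ?_⟩,
    aux h hh, aux h.symm hs⟩, fun _ => rfl, fun _ _ => rfl⟩
  · rintro ⟨b, f⟩
    refine congrArg (SpaceOver.FrameTotal.mk b) (Diffeo.ext fun e => ?_)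
    have he : (fiberDiffeo h hh b).symm ((fiberDiffeo h.symm hs b).symm e) = e :=
      Subtype.ext (h.symm_apply_apply e.1)
    exact congrArg f.toEquiv he
  · rintro ⟨b, f⟩
    refine congrArg (SpaceOver.FrameTotal.mk b) (Diffeo.ext fun e => ?_)
    have he : (fiberDiffeo h.symm hs b).symm ((fiberDiffeo h hh b).symm e) = e :=
      Subtype.ext (h.apply_symm_apply e.1)
    exact congrArg f.toEquiv he

/-- Pullback of isomorphism classes. -/
def SpaceOverClass.pullback {B' : Type u'} [DiffeologicalSpace B'] (f : B' → B) :
    SpaceOverClass.{u, w} B → SpaceOverClass.{u', max u' w} B' :=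
  Quotient.lift (fun E => (E.pullback f).toClass) fun _ _ H => Quotient.sound (H.pullback f)

/-- Pullback of isomorphism classes. -/
def GSpaceOverClass.pullback {G : Type v} [Group G] [DiffeologicalSpace G]
    {B' : Type u'} [DiffeologicalSpace B'] (f : B' → B) :
    GSpaceOverClass.{u, v, w} G B → GSpaceOverClass.{u', v, max u' w} G B' :=
  Quotient.lift (fun P => (P.pullback f).toClass) fun _ _ H => Quotient.sound (H.pullback f)

/-- The associated bundle construction `[P] ↦ [P ×_G F]` on isomorphism classes. -/
def assoc {G : Type v} [Group G] [DiffeologicalSpace G] (F : Type w') [DiffeologicalSpace F]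
    [MulAction G F] : GSpaceOverClass.{u, v, w} G B → SpaceOverClass.{u, max w w'} B :=
  Quotient.lift (fun P => (P.assoc F).toClass) fun _ _ H => Quotient.sound (H.assoc F)

/-- The frame bundle construction on isomorphism classes. -/
def frame (F : Type v) [DiffeologicalSpace F] :
    SpaceOverClass.{u, w} B → GSpaceOverClass.{u, v, max u v w} (Diff F) B :=
  Quotient.lift (fun E => (E.frame F).toClass) fun _ _ H => Quotient.sound (H.frame F)

end Classes

/-- `Prin_G(B)`: the isomorphism classes of principal `G`-bundles over `B`. -/
def Prin (G : Type v) [Group G] [DiffeologicalSpace G] [DiffeologicalGroup G]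
    (B : Type u) [DiffeologicalSpace B] : Set (GSpaceOverClass.{u, v, max u v} G B) :=
  {c | ∃ P : GSpaceOver.{u, v, max u v} G B, P.IsPrincipal ∧ P.toClass = c}

/-- `Prin_G^D(B)`: the isomorphism classes of `D`-numerable principal `G`-bundles over `B`. -/
def PrinD (G : Type v) [Group G] [DiffeologicalSpace G] [DiffeologicalGroup G]
    (B : Type u) [DiffeologicalSpace B] : Set (GSpaceOverClass.{u, v, max u v} G B) :=
  {c | ∃ P : GSpaceOver.{u, v, max u v} G B, P.IsPrincipal ∧ P.IsDNumerable ∧ P.toClass = c}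

/-- `Bun_F(B)`: the isomorphism classes of diffeological bundles over `B` with fiber `F`. -/
def Bun (F : Type v) [DiffeologicalSpace F] (B : Type u) [DiffeologicalSpace B] :
    Set (SpaceOverClass.{u, max u v} B) :=
  {c | ∃ E : SpaceOver.{u, max u v} B, E.IsBundle F ∧ E.toClass = c}

/-- `Bun_F^D(B)`: the isomorphism classes of `D`-numerable diffeological bundles over `B` with
fiber `F`. -/
def BunD (F : Type v) [DiffeologicalSpace F] (B : Type u) [DiffeologicalSpace B] :
    Set (SpaceOverClass.{u, max u v} B) :=
  {c | ∃ E : SpaceOver.{u, max u v} B, E.IsBundle F ∧ E.IsDNumerable F ∧ E.toClass = c}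

end DiffeologicalBundles

open DiffeologicalBundles

-- Everything reduces to one question: which maps `f : B' → B` lift smoothly to a given total space.
--
-- Call a space `P` over `B` with a right `G`-action a torsor if the action is free and transitive
-- on fibers and division in the fibers is smooth. A pullback of a torsor along `f` is trivial iff
-- `f` lifts to `P`: a lift gives fiber coordinates by division
-- (`IsCartesian.isTrivial_iff_hasSection`). For an arbitrary `E` over `B`, a pullback along a
-- smooth `f` is trivial of fiber type `F` iff `f` lifts to the frame bundle, because a
-- trivialization is the same thing as a smooth family of diffeomorphisms from the fibers of `E`
-- over `f b` to `F` (`IsCartesian.isTrivial_iff_hasSection_frame`). The frame bundle of every `E`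
-- is a torsor (`SpaceOver.isTorsor_frame`), so `E` is a bundle, or is `D`-numerable, exactly when
-- its frame bundle is principal, or is `D`-numerable.
--
-- For a torsor `P` under `Diff F`, sending `y` to the inverse of `x ↦ [y, x]` is a smooth,
-- injective, equivariant map from `P` to the frame bundle of its associated bundle. It carries
-- lifts to lifts, so associated bundles inherit local triviality and `D`-numerability. If plots of
-- `B` lift locally to `P`, then plots of the frame bundle lift too, since a frame over a plot
-- differs from the image of a lift by a smooth family in `Diff F`
-- (`GSpaceOver.IsTorsor.iso_frame_assoc`). In the other direction `[c, x] ↦ c⁻¹(x)` is smooth and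
-- injective from the associated bundle of the frame bundle to `E`, and plots of `E` lift along it
-- when the frame bundle has local sections (`SpaceOver.assoc_frame_iso`). In both cases an
-- injective subduction is a diffeomorphism, so smoothness of the inverse comes from lifting plots.

universe u''

namespace DiffeologicalBundles

/-! ### Diffeomorphisms from injective subductions -/

section Subduction

variable {X : Type u} {Y : Type v} [DiffeologicalSpace X] [DiffeologicalSpace Y]

/-- The plots of `Y` lift locally along `f`. -/
def LiftsPlots (f : X → Y) : Prop :=
  ∀ (n : ℕ) (p : EuclideanSpace ℝ (Fin n) → Y), IsPlot p → ∀ x,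
    ∃ q : EuclideanSpace ℝ (Fin n) → X, IsPlot q ∧ ∀ᶠ z in 𝓝 x, f (q z) = p z

/-- A point is a constant plot of dimension 0, and the value at the origin of a local lift is a
preimage. -/
theorem LiftsPlots.surjective {f : X → Y} (hf : LiftsPlots f) : Function.Surjective f := fun y => by
  obtain ⟨q, -, h⟩ := hf 0 (fun _ => y) isPlot_const 0
  exact ⟨q 0, h.self_of_nhds⟩

/-- An injective subduction is a diffeomorphism. -/
noncomputable def Diffeo.ofInjective (f : X → Y) (hf : DSmooth f) (hi : Function.Injective f)
    (hl : LiftsPlots f) : Diffeo X Y where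
  toEquiv := Equiv.ofBijective f ⟨hi, hl.surjective⟩
  smooth_toFun := hf
  smooth_invFun n p hp := isPlot_of_locally fun x => by
    obtain ⟨q, hq, h⟩ := hl n p hp x
    refine ⟨q, hq, ?_⟩
    filter_upwards [h] with z hz
    exact hi ((Equiv.apply_symm_apply (Equiv.ofBijective f ⟨hi, hl.surjective⟩) (p z)).trans
      hz.symm)

theorem dSmooth_prodMk {Z : Type w} [DiffeologicalSpace Z] {f : X → Y} {g : X → Z}
    (hf : DSmooth f) (hg : DSmooth g) : DSmooth fun x => (f x, g x) :=
  fun n p hp => isPlot_prod_iff.2 ⟨hf n p hp, hg n p hp⟩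

/-- A plot of a quotient, restricted near any point, lifts globally. -/
theorem exists_lift_quotient {s : Setoid X} {n : ℕ} {p : EuclideanSpace ℝ (Fin n) → Quotient s}
    (hp : IsPlot p) (x : EuclideanSpace ℝ (Fin n)) :
    ∃ (r : EuclideanSpace ℝ (Fin n) → EuclideanSpace ℝ (Fin n))
      (q : EuclideanSpace ℝ (Fin n) → X),
      ContDiff ℝ ((⊤ : ℕ∞) : WithTop ℕ∞) r ∧ (∀ᶠ z in 𝓝 x, r z = z) ∧ IsPlot q ∧
      ∀ z, p (r z) = Quotient.mk s (q z) := by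
  obtain ⟨q, hq, h⟩ := hp x
  obtain ⟨u, hu, huo, hxu⟩ := eventually_nhds_iff.1 h
  -- Plots are defined on all of `ℝⁿ`, so restriction to the neighbourhood `u` is replaced by
  -- precomposition with a map `r` into `u` that is the identity near `x`.
  obtain ⟨r, hr, hru, hrx⟩ := exists_smooth_retraction x huo hxu
  exact ⟨r, q ∘ r, hr, hrx, isPlot_reparam hq hr, fun z => hu _ (hru z)⟩

/-- Smoothness may be checked after reparametrization by maps that are the identity near a
point. -/
theorem isPlot_of_reparam {n : ℕ} {p : EuclideanSpace ℝ (Fin n) → X}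
    (h : ∀ x, ∃ r : EuclideanSpace ℝ (Fin n) → EuclideanSpace ℝ (Fin n),
      (∀ᶠ z in 𝓝 x, r z = z) ∧ IsPlot fun z => p (r z)) : IsPlot p :=
  isPlot_of_locally fun x => by
    obtain ⟨r, hr, h⟩ := h x
    refine ⟨_, h, ?_⟩
    filter_upwards [hr] with z hz
    rw [hz]

end Subduction

/-! ### Sections along maps and cartesian squares -/

section Sections

variable {B : Type u} [DiffeologicalSpace B] {B' : Type u'} [DiffeologicalSpace B']
  {B'' : Type u''} [DiffeologicalSpace B'']

/-- The map `f : B' → B` lifts to a smooth map into the total space. -/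
def SpaceOver.HasSection (E : SpaceOver.{u, w} B) (f : B' → B) : Prop :=
  ∃ σ : B' → E.total, DSmooth σ ∧ ∀ b, E.proj (σ b) = f b

theorem SpaceOver.HasSection.comp {E : SpaceOver.{u, w} B} {f : B' → B} (h : E.HasSection f)
    {g : B'' → B'} (hg : DSmooth g) : E.HasSection (f ∘ g) := by
  obtain ⟨σ, hσ, h⟩ := h
  exact ⟨σ ∘ g, hσ.comp hg, fun b => h _⟩

/-- Every plot of the base has, after restriction near any point, a section along it. -/
def SpaceOver.HasLocalSections (E : SpaceOver.{u, w} B) : Prop :=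
  ∀ (n : ℕ) (p : EuclideanSpace ℝ (Fin n) → B), IsPlot p → ∀ x,
    ∃ r : EuclideanSpace ℝ (Fin n) → EuclideanSpace ℝ (Fin n),
      ContDiff ℝ ((⊤ : ℕ∞) : WithTop ℕ∞) r ∧ (∀ᶠ z in 𝓝 x, r z = z) ∧ E.HasSection (p ∘ r)

theorem dSmooth_subtype_val {P : B → Prop} : DSmooth (Subtype.val : {b // P b} → B) :=
  fun _ _ hp => hp

/-- Reparametrizations suit plots, which live on all of `ℝⁿ`; open covers match the definition of
local triviality. The two are exchanged by smooth retractions into small open sets, which are the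
identity near a given point. -/
theorem SpaceOver.hasLocalSections_iff {E : SpaceOver.{u, w} B} :
    E.HasLocalSections ↔ ∀ (n : ℕ) (p : EuclideanSpace ℝ (Fin n) → B), IsPlot p →
      ∃ 𝒰 : Set (Set (EuclideanSpace ℝ (Fin n))), (∀ U ∈ 𝒰, IsOpen[dTopology] U) ∧
        ⋃₀ 𝒰 = Set.univ ∧ ∀ U ∈ 𝒰, E.HasSection (p ∘ (Subtype.val : {b // b ∈ U} → _)) := by
  constructor
  · intro h n p hp
    refine ⟨{U | IsOpen U ∧ E.HasSection (p ∘ (Subtype.val : {b // b ∈ U} → _))},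
      fun U hU => hU.1, Set.eq_univ_of_forall fun x => ?_, fun U hU => hU.2⟩
    obtain ⟨r, -, hrx, hs⟩ := h n p hp x
    obtain ⟨U, hU, hUo, hxU⟩ := eventually_nhds_iff.1 hrx
    refine ⟨U, ⟨hUo, ?_⟩, hxU⟩
    have : p ∘ (Subtype.val : {b // b ∈ U} → _) = (p ∘ r) ∘ Subtype.val :=
      funext fun z => congrArg p (hU z.1 z.2).symm
    rw [this]
    exact hs.comp dSmooth_subtype_val
  · intro h n p hp x
    obtain ⟨𝒰, ho, hc, hs⟩ := h n p hp
    obtain ⟨U, hU, hxU⟩ : x ∈ ⋃₀ 𝒰 := hc ▸ Set.mem_univ x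
    obtain ⟨r, hr, hrU, hrx⟩ := exists_smooth_retraction x (ho U hU) hxU
    refine ⟨r, hr, hrx, (hs U hU).comp (g := fun z => ⟨r z, hrU z⟩) ?_⟩
    exact fun m q hq => isPlot_subtype_iff.2 (hr.dSmooth m q hq)

/-- `k : E' → E` over `f : B' → B` exhibits `E'` as a pullback of `E`. -/
structure IsCartesian (E' : SpaceOver.{u', w'} B') (E : SpaceOver.{u, w} B) (f : B' → B)
    (k : E'.total → E.total) : Prop where
  smooth : DSmooth k
  comm : ∀ e, E.proj (k e) = f (E'.proj e)
  exists_lift : ∀ b e, f b = E.proj e → ∃ e', E'.proj e' = b ∧ k e' = e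
  ext : ∀ e e', E'.proj e = E'.proj e' → k e = k e' → e = e'
  isPlot : ∀ (n : ℕ) (p : EuclideanSpace ℝ (Fin n) → E'.total),
    IsPlot (fun z => E'.proj (p z)) → IsPlot (fun z => k (p z)) → IsPlot p

theorem isCartesian_restrict (E : SpaceOver.{u, w} B) (U : Set B) :
    IsCartesian (E.restrict U) E Subtype.val Subtype.val where
  smooth := dSmooth_subtype_val
  comm _ := rfl
  exists_lift b e h := ⟨⟨e, h ▸ b.2⟩, Subtype.ext h.symm, rfl⟩
  ext _ _ _ h := Subtype.ext h
  isPlot _ _ _ h := h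

theorem isCartesian_pullback (E : SpaceOver.{u, w} B) (f : B' → B) :
    IsCartesian (E.pullback f) E f fun z => z.1.2 where
  smooth _ _ hp := (isPlot_prod_iff.1 (isPlot_subtype_iff.1 hp)).2
  comm e := e.2.symm
  exists_lift b e h := ⟨⟨(b, e), h⟩, rfl, rfl⟩
  ext _ _ h h' := Subtype.ext (Prod.ext h h')
  isPlot _ _ h h' := isPlot_subtype_iff.2 (isPlot_prod_iff.2 ⟨h, h'⟩)

/-- Pasting of pullback squares. It allows a restriction of a pullback, or of an iterated pullback,
to be treated as one pullback along the composite map. -/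
theorem IsCartesian.comp {E'' : SpaceOver.{u'', w} B''} {E' : SpaceOver.{u', w'} B'}
    {E : SpaceOver.{u, v} B} {f : B' → B} {g : B'' → B'} {k : E'.total → E.total}
    {l : E''.total → E'.total} (hk : IsCartesian E' E f k) (hl : IsCartesian E'' E' g l)
    (hg : DSmooth g) :
    IsCartesian E'' E (f ∘ g) (k ∘ l) where
  smooth := hk.smooth.comp hl.smooth
  comm e := (hk.comm _).trans (congrArg f (hl.comm _))
  exists_lift b e h := by
    obtain ⟨e', h1, h2⟩ := hk.exists_lift (g b) e h
    obtain ⟨e'', h3, h4⟩ := hl.exists_lift b e' h1.symm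
    exact ⟨e'', h3, (congrArg k h4).trans h2⟩
  ext e e' h h' := hl.ext e e' h (hk.ext _ _ (by rw [hl.comm, hl.comm, h]) h')
  isPlot n p h h' := hl.isPlot n p h (hk.isPlot n _ (by
    simpa only [hl.comm, Function.comp_def] using hg n _ h) h')

end Sections

/-! ### Torsors -/

section Torsor

variable {G : Type v} [Group G] [DiffeologicalSpace G] {B : Type u} [DiffeologicalSpace B]
  {B' : Type u'} [DiffeologicalSpace B']

/-- The group acts simply transitively on the fibers, and division in the fibers is smooth. -/
structure GSpaceOver.IsTorsor (P : GSpaceOver.{u, v, w} G B) : Prop where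
  exists_smul_eq : ∀ y y', P.proj y = P.proj y' → ∃ g : G, MulOpposite.op g • y = y'
  free : ∀ (g g' : G) (y : P.total), MulOpposite.op g • y = MulOpposite.op g' • y → g = g'
  isPlot : ∀ (n : ℕ) (p p' : EuclideanSpace ℝ (Fin n) → P.total)
    (g : EuclideanSpace ℝ (Fin n) → G), IsPlot p → IsPlot p' →
    (∀ z, MulOpposite.op (g z) • p z = p' z) → IsPlot g

theorem GSpaceOver.isPlot_smul (P : GSpaceOver.{u, v, w} G B) {n : ℕ}
    {p : EuclideanSpace ℝ (Fin n) → P.total} {g : EuclideanSpace ℝ (Fin n) → G}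
    (hp : IsPlot p) (hg : IsPlot g) : IsPlot fun z => MulOpposite.op (g z) • p z :=
  P.smooth_action n (fun z => (p z, g z)) (isPlot_prod_iff.2 ⟨hp, hg⟩)

/-- In `B × G` the element carrying `(b, g)` to `(b, g')` is `g⁻¹ * g'`, which is smooth in both
arguments. -/
theorem GSpaceOver.IsTrivial.isTorsor [DiffeologicalGroup G] {P : GSpaceOver.{u, v, w} G B}
    (hP : P.IsTrivial) : P.IsTorsor := by
  obtain ⟨h, h1, hg⟩ := hP
  refine ⟨fun y y' hy => ⟨(h y).2⁻¹ * (h y').2, h.toEquiv.injective ?_⟩, fun g g' y H => ?_,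
    fun n p p' g hp hp' H => ?_⟩
  · refine (hg _ _).trans (Prod.ext ?_ (mul_inv_cancel_left _ _))
    exact (h1 y).trans (hy.trans (h1 y').symm)
  · have := congrArg (fun e => (h e).2) H
    simp only [hg] at this
    exact mul_left_cancel this
  · have hgz : g = fun z => (h (p z)).2⁻¹ * (h (p' z)).2 := by
      funext z
      rw [← H z, hg, inv_mul_cancel_left]
    rw [hgz]
    have h2 := (isPlot_prod_iff.1 (h.smooth n p hp)).2
    have h3 := (isPlot_prod_iff.1 (h.smooth n p' hp')).2
    exact DiffeologicalGroup.smooth_mul n (fun z => ((h (p z)).2⁻¹, (h (p' z)).2))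
      (isPlot_prod_iff.2 ⟨DiffeologicalGroup.smooth_inv n _ h2, h3⟩)

/-- Being a torsor may be checked after pullback to small open subsets of plots. -/
theorem GSpaceOver.isTorsor_of_locally {P : GSpaceOver.{u, v, w} G B}
    (H : ∀ (n : ℕ) (p : EuclideanSpace ℝ (Fin n) → B), IsPlot p → ∀ x,
      ∃ U : Set (EuclideanSpace ℝ (Fin n)), IsOpen U ∧ x ∈ U ∧
        ((P.pullback p).restrict U).IsTorsor) : P.IsTorsor := by
  refine ⟨fun y y' hy => ?_, fun g g' y hy => ?_, fun n p p' g hp hp' hg => ?_⟩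
  -- The common base point is a plot of dimension 0, and both points lie in the pullback along it.
  · obtain ⟨U, -, hx, hU⟩ := H 0 (fun _ => P.proj y) isPlot_const 0
    obtain ⟨g, hg⟩ := hU.exists_smul_eq ⟨⟨(0, y), rfl⟩, hx⟩ ⟨⟨(0, y'), hy⟩, hx⟩ rfl
    exact ⟨g, congrArg (fun e => e.1.1.2) hg⟩
  · obtain ⟨U, -, hx, hU⟩ := H 0 (fun _ => P.proj y) isPlot_const 0
    exact hU.free g g' ⟨⟨(0, y), rfl⟩, hx⟩ (Subtype.ext (Subtype.ext (Prod.ext rfl hy)))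
  · refine isPlot_of_reparam fun x => ?_
    obtain ⟨U, hUo, hx, hU⟩ := H n (fun z => P.proj (p z)) (P.smooth_proj n p hp) x
    obtain ⟨r, hr, hrU, hrx⟩ := exists_smooth_retraction x hUo hx
    -- Both plots lie over the same plot of the base, so after reparametrization by `r` they become
    -- plots of the pullback restricted to `U`, where division is smooth.
    have hpp : ∀ z, P.proj (p z) = P.proj (p' z) := fun z => by rw [← hg z, P.proj_smul]
    refine ⟨r, hrx, hU.isPlot n (fun z => ⟨⟨(r z, p (r z)), rfl⟩, hrU z⟩)
      (fun z => ⟨⟨(r z, p' (r z)), hpp _⟩, hrU z⟩) _ ?_ ?_ fun z => ?_⟩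
    · exact isPlot_prod_iff.2 ⟨hr.isPlot, isPlot_reparam hp hr⟩
    · exact isPlot_prod_iff.2 ⟨hr.isPlot, isPlot_reparam hp' hr⟩
    · exact Subtype.ext (Subtype.ext (Prod.ext rfl (hg (r z))))

theorem GSpaceOver.IsPrincipal.isTorsor [DiffeologicalGroup G] {P : GSpaceOver.{u, v, w} G B}
    (hP : P.IsPrincipal) : P.IsTorsor :=
  GSpaceOver.isTorsor_of_locally fun n p hp x => by
    obtain ⟨𝒰, ho, hc, ht⟩ := hP n p hp
    obtain ⟨U, hU, hx⟩ : x ∈ ⋃₀ 𝒰 := hc ▸ Set.mem_univ x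
    exact ⟨U, ho U hU, hx, (ht U hU).isTorsor⟩

/-- A pullback of a torsor is trivial iff the torsor has a section along the base map. -/
theorem IsCartesian.isTrivial_iff_hasSection {P' : GSpaceOver.{u', v, w'} G B'}
    {P : GSpaceOver.{u, v, w} G B} {f : B' → B} {k : P'.total → P.total}
    (hk : IsCartesian P'.toSpaceOver P.toSpaceOver f k)
    (hg : ∀ (g : G) e, k (MulOpposite.op g • e) = MulOpposite.op g • k e) (hP : P.IsTorsor) :
    P'.IsTrivial ↔ P.HasSection f := by
  constructor
  · rintro ⟨h, h1, -⟩
    -- The lift is the image of the unit section of `B' × G`.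
    have hs : DSmooth fun b : B' => (b, (1 : G)) := dSmooth_prodMk dSmooth_id' dSmooth_const
    refine ⟨fun b => k (h.symm (b, 1)), hk.smooth.comp (h.symm.smooth.comp hs), fun b => ?_⟩
    rw [hk.comm, ← h1, h.apply_symm_apply]
  · rintro ⟨σ, hσ, hσf⟩
    -- The fiber coordinate `γ e` is the quotient of `k e` by the chosen lift of its base point.
    have ex : ∀ e, ∃ g : G, MulOpposite.op g • σ (P'.proj e) = k e := fun e =>
      hP.exists_smul_eq _ _ ((hσf _).trans (hk.comm e).symm)
    choose γ hγ using ex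
    have hγs : DSmooth γ := fun n p hp =>
      hP.isPlot n (fun z => σ (P'.proj (p z))) (fun z => k (p z)) _
        (hσ n _ (P'.smooth_proj n p hp)) (hk.smooth n p hp) fun z => hγ _
    refine ⟨Diffeo.ofInjective (fun e => (P'.proj e, γ e)) (dSmooth_prodMk P'.smooth_proj hγs) ?_ ?_,
      fun e => rfl, fun g e => Prod.ext (P'.proj_smul g e) ?_⟩
    · intro e e' h
      obtain ⟨h1, h2⟩ := Prod.ext_iff.1 h
      dsimp only at h1 h2
      exact hk.ext e e' h1 (by rw [← hγ e, ← hγ e', h1, h2])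
    · intro n p hp x
      obtain ⟨h1, h2⟩ := isPlot_prod_iff.1 hp
      -- The preimage of `(b, g)` is the point over `b` whose image under `k` is `σ b · g`.
      have hl : ∀ z, ∃ e, P'.proj e = (p z).1 ∧ k e = MulOpposite.op (p z).2 • σ (p z).1 :=
        fun z => hk.exists_lift _ _ (by rw [P.proj_smul, hσf])
      choose q hq1 hq2 using hl
      refine ⟨q, hk.isPlot n q ?_ ?_, Filter.Eventually.of_forall fun z => Prod.ext (hq1 z) ?_⟩
      · simpa only [hq1] using h1
      · simpa only [hq2, Function.comp_def] using P.isPlot_smul (hσ n _ h1) h2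
      · exact hP.free _ _ (σ (p z).1) (by rw [← hq2, ← hγ, hq1])
    · refine hP.free _ _ (σ (P'.proj e)) ?_
      change _ = MulOpposite.op (γ e * g) • _
      rw [MulOpposite.op_mul, mul_smul, hγ e, ← hg, ← hγ, P'.proj_smul]
      rfl

theorem GSpaceOver.IsTorsor.isTrivial_restrict_iff {P : GSpaceOver.{u, v, w} G B}
    (hP : P.IsTorsor) (U : Set B) :
    (P.restrict U).IsTrivial ↔ P.HasSection (Subtype.val : {b // b ∈ U} → B) :=
  (isCartesian_restrict P.toSpaceOver U).isTrivial_iff_hasSection (P' := P.restrict U)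
    (fun _ _ => rfl) hP

theorem GSpaceOver.IsTorsor.isTrivial_restrict_pullback_iff {P : GSpaceOver.{u, v, w} G B}
    (hP : P.IsTorsor) (f : B' → B) (U : Set B') :
    ((P.pullback f).restrict U).IsTrivial ↔
      P.HasSection (f ∘ (Subtype.val : {b // b ∈ U} → B')) :=
  ((isCartesian_pullback P.toSpaceOver f).comp
    (isCartesian_restrict (P.toSpaceOver.pullback f) U)
      dSmooth_subtype_val).isTrivial_iff_hasSection (P' := (P.pullback f).restrict U)
        (fun _ _ => rfl) hP

/-- The triviality criterion applied over the members of open covers of the domains of plots. -/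
theorem GSpaceOver.IsTorsor.isPrincipal_iff {P : GSpaceOver.{u, v, w} G B} (hP : P.IsTorsor) :
    P.IsPrincipal ↔ P.HasLocalSections := by
  rw [SpaceOver.hasLocalSections_iff]
  simp only [GSpaceOver.IsPrincipal, GSpaceOver.IsLocallyTrivial,
    hP.isTrivial_restrict_pullback_iff]

theorem GSpaceOver.IsTorsor.isDNumerable_iff {P : GSpaceOver.{u, v, w} G B} (hP : P.IsTorsor) :
    P.IsDNumerable ↔ ∃ (ι : Type u) (U : ι → Set B), IsDNumerableCover U ∧
      ∀ i, P.HasSection (Subtype.val : {b // b ∈ U i} → B) := by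
  simp only [GSpaceOver.IsDNumerable, hP.isTrivial_restrict_iff]

theorem GSpaceOver.IsTorsor.pullback {P : GSpaceOver.{u, v, w} G B} (hP : P.IsTorsor)
    (f : B' → B) : (P.pullback f).IsTorsor where
  exists_smul_eq y y' h := by
    obtain ⟨g, hg⟩ := hP.exists_smul_eq y.1.2 y'.1.2
      (y.2.symm.trans ((congrArg f h).trans y'.2))
    exact ⟨g, Subtype.ext (Prod.ext h hg)⟩
  free g g' y h := hP.free g g' y.1.2 (congrArg (fun e => e.1.2) h)
  isPlot n p p' g hp hp' h := hP.isPlot n _ _ g (isPlot_prod_iff.1 hp).2 (isPlot_prod_iff.1 hp').2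
    fun z => congrArg (fun e => e.1.2) (h z)

end Torsor

/-! ### Frames -/

section Frame

variable {F : Type v} [DiffeologicalSpace F] {B : Type u} [DiffeologicalSpace B]
  {B' : Type u'} [DiffeologicalSpace B']

/-- Inverse frames take values in the fixed space `E.total` after forgetting the fiber, so comparing
them avoids transport along the equality of base points. -/
theorem SpaceOver.FrameTotal.ext_symm {E : SpaceOver.{u, w} B} {c d : E.FrameTotal F}
    (hb : c.base = d.base) (h : ∀ x, (c.map.symm x).1 = (d.map.symm x).1) : c = d := by
  obtain ⟨b, φ⟩ := c
  obtain ⟨b', ψ⟩ := d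
  obtain rfl : b = b' := hb
  refine congrArg (SpaceOver.FrameTotal.mk b) (Diffeo.ext fun e => ?_)
  have : φ.symm (ψ e) = e := Subtype.ext ((h (ψ e)).trans (congrArg _ (ψ.symm_apply_apply e)))
  rw [← this, φ.apply_symm_apply, this]

/-- The equation `ψ = g⁻¹ ∘ φ` has the unique solution `g = φ ∘ ψ⁻¹`. Smoothness in families follows
by feeding the inverse of one frame plot into the evaluation of the other. No local triviality of
`E` enters. -/
theorem SpaceOver.isTorsor_frame (E : SpaceOver.{u, w} B) : (E.frame F).IsTorsor where
  exists_smul_eq := by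
    rintro ⟨b, φ⟩ ⟨b', ψ⟩ h
    obtain rfl : b = b' := h
    refine ⟨ψ.symm.trans φ, SpaceOver.FrameTotal.ext_symm rfl fun x => ?_⟩
    exact congrArg Subtype.val (φ.symm_apply_apply _)
  free g g' c h := by
    refine Diffeo.ext fun x => c.map.symm.toEquiv.injective ?_
    refine Subtype.ext ?_
    -- The two frames have fiber types depending on their base points; evaluating both at a point of
    -- `E.total` with separate membership proofs avoids a cast.
    have h' : ∀ d : (E.frame F).total, MulOpposite.op g • c = d →
        ∀ e he he', (MulOpposite.op g • c : (E.frame F).total).map ⟨e, he⟩ = d.map ⟨e, he'⟩ := by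
      rintro _ rfl e he he'
      rfl
    have h1 := h' _ h (c.map.symm (g x)).1 (c.map.symm (g x)).2 (c.map.symm (g x)).2
    have h2 : g.symm (c.map (c.map.symm (g x))) = g'.symm (c.map (c.map.symm (g x))) := h1
    rw [c.map.apply_symm_apply, g.symm_apply_apply] at h2
    have h3 : g x = g' x := by
      conv_rhs => rw [h2]
      exact (g'.apply_symm_apply _).symm
    exact congrArg (fun y => (c.map.symm y).1) h3
  isPlot n p p' g hp hp' h := by
    obtain rfl : (fun z => MulOpposite.op (g z) • p z) = p' := funext h
    have hp1 : E.IsFramePlot p := hp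
    have hp2 : E.IsFramePlot fun z => (MulOpposite.op (g z) • p z : (E.frame F).total) := hp'
    constructor
    -- Here `g = p ∘ (p · g)⁻¹`; the second half below uses `g⁻¹ = (p · g) ∘ p⁻¹`.
    · intro m q hq
      obtain ⟨h1, h2⟩ := isPlot_prod_iff.1 hq
      have h3 := hp1.eval m
        (fun t => ⟨((q t).1, ((p (q t).1).map.symm (g (q t).1 (q t).2)).1),
          ((p (q t).1).map.symm (g (q t).1 (q t).2)).2⟩)
        (isPlot_subtype_iff.2 (isPlot_prod_iff.2 ⟨h1, hp2.inv m q hq⟩))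
      refine cast (congrArg IsPlot (funext fun t => ?_)) h3
      exact (p (q t).1).map.apply_symm_apply _
    · intro m q hq
      obtain ⟨h1, h2⟩ := isPlot_prod_iff.1 hq
      have h3 := hp2.eval m
        (fun t => ⟨((q t).1, ((p (q t).1).map.symm (q t).2).1),
          ((p (q t).1).map.symm (q t).2).2⟩)
        (isPlot_subtype_iff.2 (isPlot_prod_iff.2 ⟨h1, hp1.inv m q hq⟩))
      refine cast (congrArg IsPlot (funext fun t => ?_)) h3
      exact congrArg (g (q t).1).symm ((p (q t).1).map.apply_symm_apply _)

/-- A pullback of `E` is trivial iff the frame bundle of `E` has a section along the base map. -/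
theorem IsCartesian.isTrivial_iff_hasSection_frame {E' : SpaceOver.{u', w'} B'}
    {E : SpaceOver.{u, w} B} {f : B' → B} {k : E'.total → E.total} (hk : IsCartesian E' E f k)
    (hf : DSmooth f) : E'.IsTrivial F ↔ (E.frame F).HasSection f := by
  constructor
  · rintro ⟨h, h1⟩
    have hs : ∀ z, E'.proj (h.symm z) = z.1 := fun z => by rw [← h1, h.apply_symm_apply]
    have hsk : ∀ z, E.proj (k (h.symm z)) = f z.1 := fun z => by rw [hk.comm, hs]
    -- A plot of `E` lying over `f ∘ b` has a smooth fiber coordinate in the trivialization. This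
    -- gives smoothness of each single frame and of the evaluation of the whole family.
    have lift : ∀ {n : ℕ} (b : EuclideanSpace ℝ (Fin n) → B')
        (e : EuclideanSpace ℝ (Fin n) → E.total), IsPlot b → IsPlot e →
        (∀ z, f (b z) = E.proj (e z)) →
        ∃ x : EuclideanSpace ℝ (Fin n) → F, IsPlot x ∧ ∀ z, k (h.symm (b z, x z)) = e z := by
      intro n b e hb he hbe
      choose q hq1 hq2 using fun z => hk.exists_lift (b z) (e z) (hbe z)
      have hq : IsPlot q := hk.isPlot n q (by simpa only [hq1] using hb)
        (by simpa only [hq2] using he)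
      refine ⟨fun z => (h (q z)).2, (isPlot_prod_iff.1 (h.smooth n q hq)).2, fun z => ?_⟩
      rw [← hq2, ← hq1, ← h1, Prod.mk.eta, h.symm_apply_apply]
    have inj : ∀ b x x', k (h.symm (b, x)) = k (h.symm (b, x')) → x = x' := fun b x x' H =>
      congrArg Prod.snd (h.symm.toEquiv.injective (a₁ := (b, x)) (a₂ := (b, x'))
        (hk.ext _ _ ((hs (b, x)).trans (hs (b, x')).symm) H))
    let φ : ∀ b, Diffeo F (E.Fiber (f b)) := fun b =>
      Diffeo.ofInjective (fun x => ⟨k (h.symm (b, x)), hsk _⟩)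
        (fun n p hp => isPlot_subtype_iff.2 (hk.smooth n _ (h.symm.smooth n _
          (isPlot_prod_iff.2 ⟨isPlot_const, hp⟩))))
        (fun x x' H => inj b x x' (congrArg Subtype.val H))
        (fun n p hp x => by
          obtain ⟨q, hq, hqe⟩ := lift (fun _ => b) _ isPlot_const (isPlot_subtype_iff.1 hp)
            (fun z => (p z).2.symm)
          exact ⟨q, hq, Filter.Eventually.of_forall fun z => Subtype.ext (hqe z)⟩)
    have hφ : ∀ b x, (φ b x).1 = k (h.symm (b, x)) := fun _ _ => rfl
    refine ⟨fun b => ⟨f b, (φ b).symm⟩, fun n p hp => ?_, fun _ => rfl⟩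
    exact
      { base := hf n p hp
        eval := fun m q hq => by
          obtain ⟨h2, h3⟩ := isPlot_prod_iff.1 (isPlot_subtype_iff.1 hq)
          obtain ⟨x, hx, hxe⟩ := lift (fun z => p (q z).1.1) (fun z => (q z).1.2)
            (hp.dSmooth m _ h2) h3 (fun z => (q z).2.symm)
          refine cast (congrArg IsPlot (funext fun z => ?_)) hx
          have : φ (p (q z).1.1) (x z) = ⟨(q z).1.2, (q z).2⟩ := Subtype.ext (hxe z)
          exact ((φ (p (q z).1.1)).symm_apply_apply (x z)).symm.trans
            (congrArg (φ (p (q z).1.1)).symm this)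
        inv := fun m q hq => by
          obtain ⟨h2, h3⟩ := isPlot_prod_iff.1 hq
          exact hk.smooth m _ (h.symm.smooth m (fun z => (p (q z).1, (q z).2))
            (isPlot_prod_iff.2 ⟨hp.dSmooth m _ h2, h3⟩)) }
  · rintro ⟨σ, hσ, hσf⟩
    have hb : ∀ e, E.proj (k e) = (σ (E'.proj e)).base := fun e => (hk.comm e).trans (hσf _).symm
    -- Replaces a frame by an equal one although the membership proof of the argument depends on the
    -- frame.
    have ev : ∀ (c d : E.FrameTotal F) e he he', c = d → c.map ⟨e, he⟩ = d.map ⟨e, he'⟩ := by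
      rintro c _ e he he' rfl
      rfl
    refine ⟨Diffeo.ofInjective (fun e => (E'.proj e, (σ (E'.proj e)).map ⟨k e, hb e⟩))
      (dSmooth_prodMk E'.smooth_proj fun n p hp => ?_) (fun e e' h => ?_) fun n p hp x => ?_,
      fun e => rfl⟩
    · have h2 : E.IsFramePlot fun z => σ (E'.proj (p z)) := hσ n _ (E'.smooth_proj n p hp)
      exact h2.eval n (fun z => ⟨(z, k (p z)), hb _⟩)
        (isPlot_subtype_iff.2 (isPlot_prod_iff.2 ⟨isPlot_id', hk.smooth n p hp⟩))
    · obtain ⟨h1, h2⟩ := Prod.ext_iff.1 h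
      dsimp only at h1 h2
      refine hk.ext e e' h1 ?_
      rw [ev _ _ _ _ ((hb e).trans (by rw [h1])) (congrArg σ h1)] at h2
      exact congrArg Subtype.val ((σ (E'.proj e')).map.toEquiv.injective h2)
    · obtain ⟨h1, h2⟩ := isPlot_prod_iff.1 hp
      have h3 : E.IsFramePlot fun z => σ (p z).1 := hσ n _ h1
      -- The preimage of `(b, x)` lies over `b` and is mapped by `k` to `(σ b)⁻¹(x)`.
      choose q hq1 hq2 using fun z => hk.exists_lift (p z).1 ((σ (p z).1).map.symm (p z).2).1
        ((hσf _).symm.trans ((σ (p z).1).map.symm (p z).2).2.symm)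
      refine ⟨q, hk.isPlot n q (by simpa only [hq1] using h1) ?_,
        Filter.Eventually.of_forall fun z => Prod.ext (hq1 z) ?_⟩
      · simp only [hq2]
        exact h3.inv n (fun z => (z, (p z).2)) (isPlot_prod_iff.2 ⟨isPlot_id', h2⟩)
      · refine (ev _ _ _ _ ((hb _).trans (by rw [hq1])) (congrArg σ (hq1 z))).trans ?_
        refine (congrArg (σ (p z).1).map.toEquiv (Subtype.ext (hq2 z))).trans ?_
        exact (σ (p z).1).map.apply_symm_apply _

theorem SpaceOver.isTrivial_restrict_iff (E : SpaceOver.{u, w} B) (U : Set B) :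
    (E.restrict U).IsTrivial F ↔ (E.frame F).HasSection (Subtype.val : {b // b ∈ U} → B) :=
  (isCartesian_restrict E U).isTrivial_iff_hasSection_frame dSmooth_subtype_val

theorem SpaceOver.isTrivial_restrict_pullback_iff (E : SpaceOver.{u, w} B) {f : B' → B}
    (hf : DSmooth f) (U : Set B') :
    ((E.pullback f).restrict U).IsTrivial F ↔
      (E.frame F).HasSection (f ∘ (Subtype.val : {b // b ∈ U} → B')) :=
  ((isCartesian_pullback E f).comp (isCartesian_restrict (E.pullback f) U)
    dSmooth_subtype_val).isTrivial_iff_hasSection_frame (hf.comp dSmooth_subtype_val)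

/-- The condition is the one that characterizes principal bundles among torsors, read for the frame
bundle. -/
theorem SpaceOver.isBundle_iff (E : SpaceOver.{u, w} B) :
    E.IsBundle F ↔ (E.frame F).HasLocalSections := by
  rw [SpaceOver.hasLocalSections_iff]
  refine forall_congr' fun n => forall_congr' fun p => forall_congr' fun hp => ?_
  simp only [SpaceOver.IsLocallyTrivial, E.isTrivial_restrict_pullback_iff hp.dSmooth]

theorem SpaceOver.isDNumerable_iff (E : SpaceOver.{u, w} B) :
    E.IsDNumerable F ↔ ∃ (ι : Type u) (U : ι → Set B), IsDNumerableCover U ∧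
      ∀ i, (E.frame F).HasSection (Subtype.val : {b // b ∈ U i} → B) := by
  simp only [SpaceOver.IsDNumerable, E.isTrivial_restrict_iff]

end Frame

variable {F : Type v} [DiffeologicalSpace F] {B : Type u} [DiffeologicalSpace B]
  {B' : Type u'} [DiffeologicalSpace B']

/-! ### The frame bundle of an associated bundle -/

namespace GSpaceOver

/-- The class `[y, x]` in the associated bundle. -/
def assocMk (P : GSpaceOver.{u, v, w} (Diff F) B) (y : P.total) (x : F) : (P.assoc F).total :=
  Quotient.mk (assocSetoid F P) (y, x)

theorem isPlot_assocMk (P : GSpaceOver.{u, v, w} (Diff F) B) {n : ℕ}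
    {p : EuclideanSpace ℝ (Fin n) → P.total} {q : EuclideanSpace ℝ (Fin n) → F}
    (hp : IsPlot p) (hq : IsPlot q) : IsPlot fun z => P.assocMk (p z) (q z) :=
  dSmooth_quotient_mk (assocSetoid F P) n (fun z => (p z, q z)) (isPlot_prod_iff.2 ⟨hp, hq⟩)

theorem assocMk_smul (P : GSpaceOver.{u, v, w} (Diff F) B) (g : Diff F) (y : P.total) (x : F) :
    P.assocMk (MulOpposite.op g • y) x = P.assocMk y (g x) :=
  (Quotient.sound ⟨g, Prod.ext rfl (g.symm_apply_apply x).symm⟩ :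
    P.assocMk y (g x) = P.assocMk (MulOpposite.op g • y) x).symm

theorem assocMk_eq_iff (P : GSpaceOver.{u, v, w} (Diff F) B) {y y' : P.total} {x x' : F} :
    P.assocMk y x = P.assocMk y' x' ↔ ∃ g : Diff F, MulOpposite.op g • y = y' ∧ x = g x' := by
  constructor
  · intro h
    obtain ⟨g, hg⟩ := Quotient.exact h
    obtain ⟨h1, h2⟩ := Prod.ext_iff.1 hg
    exact ⟨g, h1.symm, by rw [show x' = g.symm x from h2, g.apply_symm_apply]⟩
  · rintro ⟨g, rfl, rfl⟩
    exact (P.assocMk_smul g y x').symm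

namespace IsTorsor

variable {P : GSpaceOver.{u, v, w} (Diff F) B}

/-- Two representatives with the same first component differ by an element fixing `y`, which is `1`
by freeness. -/
theorem assocMk_injective (hP : P.IsTorsor) (y : P.total) : Function.Injective (P.assocMk y) := by
  intro x x' h
  obtain ⟨g, h1, h2⟩ := P.assocMk_eq_iff.1 h
  have : g = 1 := hP.free g 1 y (by rw [h1, MulOpposite.op_one, one_smul])
  rw [h2, this]
  rfl

/-- Near any point, a plot of the associated bundle over a plot `y` of the base given by `P` has
the form `[y, x]` for a plot `x` of the fiber. -/
theorem exists_assocMk_eq (hP : P.IsTorsor) {n : ℕ}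
    {y : EuclideanSpace ℝ (Fin n) → P.total}
    {p : EuclideanSpace ℝ (Fin n) → (P.assoc F).total} (hy : IsPlot y) (hp : IsPlot p)
    (h : ∀ z, (P.assoc F).proj (p z) = P.proj (y z)) (t : EuclideanSpace ℝ (Fin n)) :
    ∃ (r : EuclideanSpace ℝ (Fin n) → EuclideanSpace ℝ (Fin n))
      (x : EuclideanSpace ℝ (Fin n) → F), (∀ᶠ z in 𝓝 t, r z = z) ∧ IsPlot x ∧
      ∀ z, P.assocMk (y (r z)) (x z) = p (r z) := by
  obtain ⟨r, q, hr, hrt, hq, hpq⟩ := exists_lift_quotient hp t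
  obtain ⟨hq1, hq2⟩ := isPlot_prod_iff.1 hq
  have hb : ∀ z, P.proj (y (r z)) = P.proj (q z).1 := fun z =>
    (h (r z)).symm.trans (congrArg (P.assoc F).proj (hpq z))
  -- With `p = [q₁, q₂]` and `q₁ = y · g`, one has `p = [y, g(q₂)]`, and `g` is smooth because
  -- division is.
  choose g hg using fun z => hP.exists_smul_eq _ _ (hb z)
  have hgp : IsPlot g := hP.isPlot n _ _ g (isPlot_reparam hy hr) hq1 hg
  refine ⟨r, fun z => g z (q z).2, hrt, ?_, fun z => ?_⟩
  · exact hgp.1 n (fun z => (z, (q z).2)) (isPlot_prod_iff.2 ⟨isPlot_id', hq2⟩)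
  · rw [← P.assocMk_smul, hg, hpq]
    rfl

/-- The diffeomorphism `x ↦ [y, x]` from `F` to a fiber of the associated bundle. -/
noncomputable def fiberDiffeo (hP : P.IsTorsor) (y : P.total) :
    Diffeo F ((P.assoc F).Fiber (P.proj y)) :=
  Diffeo.ofInjective (fun x => ⟨P.assocMk y x, rfl⟩)
    (fun _ _ hp => isPlot_subtype_iff.2 (P.isPlot_assocMk isPlot_const hp))
    (fun _ _ h => hP.assocMk_injective y (congrArg Subtype.val h))
    (fun n p hp t => by
      obtain ⟨r, x, hrt, hx, h⟩ := hP.exists_assocMk_eq (y := fun _ => y) isPlot_const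
        (isPlot_subtype_iff.1 hp) (fun z => (p z).2) t
      refine ⟨x, hx, ?_⟩
      filter_upwards [hrt] with z hz
      exact Subtype.ext ((h z).trans (by rw [hz])))

/-- The point `y` as a frame of the associated bundle. -/
noncomputable def toFrame (hP : P.IsTorsor) (y : P.total) : ((P.assoc F).frame F).total :=
  ⟨P.proj y, (hP.fiberDiffeo y).symm⟩

/-- The inverse frames are `x ↦ [y, x]`, visibly smooth in `y` and `x`. Evaluation of the frames is
smooth because plots of the associated bundle over a plot of `P` have smooth fiber coordinates
(`exists_assocMk_eq`). -/
theorem dSmooth_toFrame (hP : P.IsTorsor) : DSmooth hP.toFrame := by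
  intro n p hp
  exact
    { base := P.smooth_proj n p hp
      eval := fun m q hq => by
        obtain ⟨h1, h2⟩ := isPlot_prod_iff.1 (isPlot_subtype_iff.1 hq)
        refine isPlot_of_reparam fun t => ?_
        obtain ⟨r, x, hrt, hx, h⟩ := hP.exists_assocMk_eq (y := fun z => p (q z).1.1)
          (hp.dSmooth m _ h1) h2 (fun z => (q z).2) t
        refine ⟨r, hrt, cast (congrArg IsPlot (funext fun z => ?_)) hx⟩
        have : hP.fiberDiffeo (p (q (r z)).1.1) (x z) = ⟨(q (r z)).1.2, (q (r z)).2⟩ :=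
          Subtype.ext (h z)
        exact ((hP.fiberDiffeo (p (q (r z)).1.1)).symm_apply_apply (x z)).symm.trans
          (congrArg (hP.fiberDiffeo (p (q (r z)).1.1)).symm this)
      inv := fun m q hq => by
        obtain ⟨h1, h2⟩ := isPlot_prod_iff.1 hq
        exact P.isPlot_assocMk (hp.dSmooth m _ h1) h2 }

theorem toFrame_smul (hP : P.IsTorsor) (g : Diff F) (y : P.total) :
    hP.toFrame (MulOpposite.op g • y) = MulOpposite.op g • hP.toFrame y :=
  SpaceOver.FrameTotal.ext_symm (P.proj_smul g y) fun x => P.assocMk_smul g y x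

/-- Points with the same frame lie in one fiber, so they differ by some `g`; this `g` fixes the
frame, and the action on frames is free. -/
theorem toFrame_injective (hP : P.IsTorsor) : Function.Injective hP.toFrame := by
  intro y y' h
  have hb : P.proj y = P.proj y' := congrArg SpaceOver.FrameTotal.base h
  obtain ⟨g, rfl⟩ := hP.exists_smul_eq y y' hb
  rw [hP.toFrame_smul] at h
  have : (1 : Diff F) = g := ((P.assoc F).isTorsor_frame (F := F)).free 1 g (hP.toFrame y)
    (by rw [MulOpposite.op_one, one_smul]; exact h)
  rw [← this, MulOpposite.op_one, one_smul]

theorem hasSection_frame_assoc (hP : P.IsTorsor) {f : B' → B} (h : P.HasSection f) :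
    ((P.assoc F).frame F).HasSection f := by
  obtain ⟨σ, hσ, hf⟩ := h
  exact ⟨hP.toFrame ∘ σ, hP.dSmooth_toFrame.comp hσ, hf⟩

/-- A principal bundle is the frame bundle of its associated bundle. -/
theorem iso_frame_assoc (hP : P.IsTorsor) (hs : P.HasLocalSections) :
    P.Iso ((P.assoc F).frame F) := by
  refine ⟨Diffeo.ofInjective hP.toFrame hP.dSmooth_toFrame hP.toFrame_injective
    fun n p hp t => ?_, fun _ => rfl, hP.toFrame_smul⟩
  obtain ⟨r, hr, hrt, σ, hσ, hσp⟩ := hs n _ (((P.assoc F).frame F).smooth_proj n p hp) t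
  have hT := (P.assoc F).isTorsor_frame (F := F)
  -- The given frames and those of the local lift `σ` differ by a smooth family `g`, so `σ · g` is
  -- the required lift of the plot to `P`.
  choose g hg using fun z => hT.exists_smul_eq (hP.toFrame (σ z)) (p (r z)) (hσp z)
  have hgp : IsPlot g := hT.isPlot n _ _ g (hP.dSmooth_toFrame n _ hσ.isPlot)
    (isPlot_reparam hp hr) hg
  refine ⟨fun z => MulOpposite.op (g z) • σ z, P.isPlot_smul hσ.isPlot hgp, ?_⟩
  filter_upwards [hrt] with z hz
  refine (hP.toFrame_smul _ _).trans ((hg z).trans ?_)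
  rw [hz]

end IsTorsor

/-- The associated bundle of a pullback is the pullback of the associated bundle. -/
theorem assoc_pullback_iso (P : GSpaceOver.{u, v, w} (Diff F) B) (f : B' → B) :
    ((P.pullback f).assoc F).Iso ((P.assoc F).pullback f) := by
  let k : ((P.pullback f).assoc F).total → ((P.assoc F).pullback f).total :=
    Quotient.lift (fun z : (P.pullback f).total × F => ⟨(z.1.1.1, P.assocMk z.1.1.2 z.2), z.1.2⟩)
      (by
        rintro ⟨⟨⟨b, y⟩, hy⟩, x⟩ _ ⟨g, rfl⟩
        refine Subtype.ext (Prod.ext rfl ?_)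
        exact P.assocMk_eq_iff.2 ⟨g, rfl, (g.apply_symm_apply x).symm⟩)
  have hk : DSmooth k := dSmooth_quotient_of_comp fun n p hp => by
    obtain ⟨h1, h2⟩ := isPlot_prod_iff.1 hp
    obtain ⟨h3, h4⟩ := isPlot_prod_iff.1 (isPlot_subtype_iff.1 h1)
    exact isPlot_subtype_iff.2 (isPlot_prod_iff.2 ⟨h3, P.isPlot_assocMk h4 h2⟩)
  have hki : Function.Injective k := by
    intro e e'
    induction e using Quotient.inductionOn with
    | h z =>
      induction e' using Quotient.inductionOn with
      | h z' =>
        intro h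
        obtain ⟨h1, h2⟩ := Prod.ext_iff.1 (congrArg Subtype.val h)
        obtain ⟨g, hg, hx⟩ := P.assocMk_eq_iff.1 h2
        exact (P.pullback f).assocMk_eq_iff.2 ⟨g, Subtype.ext (Prod.ext h1 hg), hx⟩
  refine ⟨Diffeo.ofInjective k hk hki fun n p hp t => ?_, fun e => ?_⟩
  · obtain ⟨h1, h2⟩ := isPlot_prod_iff.1 (isPlot_subtype_iff.1 hp)
    obtain ⟨r, q, hr, hrt, hq, hpq⟩ := exists_lift_quotient h2 t
    obtain ⟨hq1, hq2⟩ := isPlot_prod_iff.1 hq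
    -- Only the component in the associated bundle has to be lifted; the lift stays over the
    -- `B'`-component because `[y, x]` and `y` have the same base point.
    have hb : ∀ z, f (p (r z)).1.1 = P.proj (q z).1 := fun z =>
      (p (r z)).2.trans (congrArg (P.assoc F).proj (hpq z))
    refine ⟨fun z => (P.pullback f).assocMk ⟨((p (r z)).1.1, (q z).1), hb z⟩ (q z).2,
      (P.pullback f).isPlot_assocMk (isPlot_subtype_iff.2
        (isPlot_prod_iff.2 ⟨isPlot_reparam h1 hr, hq1⟩)) hq2, ?_⟩
    filter_upwards [hrt] with z hz
    refine Subtype.ext (Prod.ext (congrArg (fun z => (p z).1.1) hz) ?_)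
    exact (hpq z).symm.trans (by rw [hz])
  · induction e using Quotient.inductionOn with
    | h z => rfl

end GSpaceOver

/-! ### The associated bundle of a frame bundle -/

/-- A bundle is the associated bundle of its frame bundle. -/
theorem SpaceOver.assoc_frame_iso {E : SpaceOver.{u, w} B} (hs : (E.frame F).HasLocalSections) :
    ((E.frame F).assoc F).Iso E := by
  let k : ((E.frame F).assoc F).total → E.total :=
    Quotient.lift (fun z : (E.frame F).total × F => (z.1.map.symm z.2).1) (by
      rintro ⟨c, x⟩ _ ⟨g, rfl⟩
      exact congrArg (fun y => (c.map.symm y).1) (g.apply_symm_apply x).symm)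
  have hkm : ∀ c x, k ((E.frame F).assocMk c x) = (c.map.symm x).1 := fun _ _ => rfl
  have hk : DSmooth k := dSmooth_quotient_of_comp fun n p hp => by
    obtain ⟨h1, h2⟩ := isPlot_prod_iff.1 hp
    exact SpaceOver.IsFramePlot.inv h1 n (fun z => (z, (p z).2))
      (isPlot_prod_iff.2 ⟨isPlot_id', h2⟩)
  have hki : Function.Injective k := by
    intro e e'
    induction e using Quotient.inductionOn with
    | h z =>
      induction e' using Quotient.inductionOn with
      | h z' =>
        obtain ⟨c, x⟩ := z
        obtain ⟨c', x'⟩ := z'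
        intro h
        have h1 : (c.map.symm x).1 = (c'.map.symm x').1 := h
        have hb : c.base = c'.base :=
          (c.map.symm x).2.symm.trans ((congrArg E.proj h1).trans (c'.map.symm x').2)
        -- With `c' = c · g` the inverse frame is `x' ↦ c⁻¹(g x')`, so equal images give `x = g x'`.
        obtain ⟨g, rfl⟩ := E.isTorsor_frame.exists_smul_eq c c' hb
        refine (E.frame F).assocMk_eq_iff.2 ⟨g, rfl, c.map.symm.toEquiv.injective ?_⟩
        exact Subtype.ext h1
  refine ⟨Diffeo.ofInjective k hk hki fun n p hp t => ?_, fun e => ?_⟩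
  · obtain ⟨r, hr, hrt, σ, hσ, hσp⟩ := hs n _ (E.smooth_proj n p hp) t
    have hσ' : E.IsFramePlot σ := hσ.isPlot
    have hb : ∀ z, E.proj (p (r z)) = (σ z).base := fun z => (hσp z).symm
    -- A point `e` over the base point of a frame `c` is the image of `[c, c(e)]`.
    refine ⟨fun z => (E.frame F).assocMk (σ z) ((σ z).map ⟨p (r z), hb z⟩),
      (E.frame F).isPlot_assocMk hσ.isPlot (hσ'.eval n (fun z => ⟨(z, p (r z)), hb z⟩)
        (isPlot_subtype_iff.2 (isPlot_prod_iff.2 ⟨isPlot_id', isPlot_reparam hp hr⟩))), ?_⟩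
    filter_upwards [hrt] with z hz
    refine (congrArg Subtype.val ((σ z).map.symm_apply_apply ⟨p (r z), hb z⟩)).trans ?_
    exact congrArg p hz
  · induction e using Quotient.inductionOn with
    | h z => exact (z.1.map.symm z.2).2

/-! ### Pullbacks -/

/-- Smooth maps are continuous for the `D`-topologies, so the support of `μ i ∘ f` lies in the
preimage of the support of `μ i`; local finiteness and subordination pass to the preimages. -/
theorem IsDNumerableCover.preimage {ι : Type w} {U : ι → Set B} (hU : IsDNumerableCover U)
    {f : B' → B} (hf : DSmooth f) : IsDNumerableCover fun i => f ⁻¹' U i := by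
  let _ : TopologicalSpace B := dTopology
  let _ : TopologicalSpace B' := dTopology
  have hc : Continuous f := hf.continuous
  obtain ⟨μ, hμ, hs⟩ := hU.exists_partition
  have hsub : ∀ i, dSupport (μ i ∘ f) ⊆ f ⁻¹' dSupport (μ i) := fun i =>
    hc.closure_preimage_subset (μ i ⁻¹' Set.Ioi 0)
  exact
    { isOpen := fun i => (hU.isOpen i).preimage hc
      cover := by rw [← Set.preimage_iUnion, hU.cover, Set.preimage_univ]
      exists_partition := ⟨fun i => μ i ∘ f,
        { smooth := fun i => (hμ.smooth i).comp hf
          nonneg := fun i x => hμ.nonneg i (f x)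
          locallyFinite := (hμ.locallyFinite.preimage_continuous hc).subset hsub
          sum_eq_one := fun x => hμ.sum_eq_one (f x) },
        fun i => (hsub i).trans (Set.preimage_mono (hs i))⟩ }

theorem dSmooth_restrictPreimage {f : B' → B} (hf : DSmooth f) (U : Set B) :
    DSmooth fun b : {b // b ∈ f ⁻¹' U} => (⟨f b.1, b.2⟩ : {b // b ∈ U}) :=
  fun n p hp => hf n (fun z => (p z).1) hp

/-- A lift of `f ∘ p` to `P`, paired with `p`, is a lift of `p` to the pullback, over the same open
sets. -/
theorem GSpaceOver.IsPrincipal.pullback {G : Type v} [Group G] [DiffeologicalSpace G]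
    [DiffeologicalGroup G] {P : GSpaceOver.{u, v, w} G B} (hP : P.IsPrincipal) {f : B' → B}
    (hf : DSmooth f) : (P.pullback f).IsPrincipal := by
  intro n p hp
  obtain ⟨𝒰, ho, hc, ht⟩ := hP n (f ∘ p) (hf n p hp)
  refine ⟨𝒰, ho, hc, fun U hU => ?_⟩
  have hT := hP.isTorsor
  obtain ⟨σ, hσ, h⟩ := (hT.isTrivial_restrict_pullback_iff _ U).1 (ht U hU)
  refine ((hT.pullback f).isTrivial_restrict_pullback_iff p U).2
    ⟨fun b => ⟨(p b.1, σ b), (h b).symm⟩, ?_, fun b => rfl⟩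
  exact dSmooth_prodMk (hp.dSmooth.comp dSmooth_subtype_val) hσ

/-- Pasting the squares for `f`, for the plot and for the restriction gives one cartesian square
over `E`, so the criterion is again a lift of `f ∘ p` to the frame bundle of `E`. -/
theorem SpaceOver.IsBundle.pullback {E : SpaceOver.{u, w} B} (hE : E.IsBundle F) {f : B' → B}
    (hf : DSmooth f) : (E.pullback f).IsBundle F := by
  intro n p hp
  obtain ⟨𝒰, ho, hc, ht⟩ := hE n (f ∘ p) (hf n p hp)
  refine ⟨𝒰, ho, hc, fun U hU => ?_⟩
  exact ((((isCartesian_pullback E f).comp (isCartesian_pullback (E.pullback f) p)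
    hp.dSmooth).comp (isCartesian_restrict _ U)
      dSmooth_subtype_val).isTrivial_iff_hasSection_frame
        ((hf.comp hp.dSmooth).comp dSmooth_subtype_val)).2
      ((E.isTrivial_restrict_pullback_iff (hf.comp hp.dSmooth) U).1 (ht U hU))

theorem GSpaceOver.IsTorsor.isDNumerable_pullback {B' : Type u} [DiffeologicalSpace B']
    {G : Type v} [Group G] [DiffeologicalSpace G] {P : GSpaceOver.{u, v, w} G B}
    (hT : P.IsTorsor) (hP : P.IsDNumerable) {f : B' → B} (hf : DSmooth f) :
    (P.pullback f).IsDNumerable := by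
  obtain ⟨ι, U, hU, hs⟩ := hT.isDNumerable_iff.1 hP
  refine (hT.pullback f).isDNumerable_iff.2 ⟨ι, _, hU.preimage hf, fun i => ?_⟩
  obtain ⟨σ, hσ, h⟩ := (hs i).comp (dSmooth_restrictPreimage hf (U i))
  refine ⟨fun b => ⟨(b.1, σ b), (h b).symm⟩, ?_, fun b => rfl⟩
  exact dSmooth_prodMk dSmooth_subtype_val hσ

theorem SpaceOver.IsDNumerable.pullback {B' : Type u} [DiffeologicalSpace B']
    {E : SpaceOver.{u, w} B} (hE : E.IsDNumerable F) {f : B' → B} (hf : DSmooth f) :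
    (E.pullback f).IsDNumerable F := by
  obtain ⟨ι, U, hU, hs⟩ := E.isDNumerable_iff.1 hE
  refine ⟨ι, _, hU.preimage hf, fun i => ?_⟩
  exact (((isCartesian_pullback E f).comp (isCartesian_restrict _ (f ⁻¹' U i))
    dSmooth_subtype_val).isTrivial_iff_hasSection_frame (hf.comp dSmooth_subtype_val)).2
      ((hs i).comp (dSmooth_restrictPreimage hf (U i)))

/-! ### The correspondence between principal bundles and bundles -/

/-- Local lifts to `P` are carried by `toFrame` to local lifts to the frame bundle of the associated
bundle. -/
theorem GSpaceOver.IsPrincipal.isBundle_assoc {P : GSpaceOver.{u, v, w} (Diff F) B}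
    (hP : P.IsPrincipal) : (P.assoc F).IsBundle F := by
  refine (P.assoc F).isBundle_iff.2 fun n p hp x => ?_
  obtain ⟨r, hr, hrx, hs⟩ := hP.isTorsor.isPrincipal_iff.1 hP n p hp x
  exact ⟨r, hr, hrx, hP.isTorsor.hasSection_frame_assoc hs⟩

theorem GSpaceOver.IsTorsor.isDNumerable_assoc {P : GSpaceOver.{u, v, w} (Diff F) B}
    (hT : P.IsTorsor) (hP : P.IsDNumerable) : (P.assoc F).IsDNumerable F := by
  obtain ⟨ι, U, hU, hs⟩ := hT.isDNumerable_iff.1 hP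
  exact (P.assoc F).isDNumerable_iff.2 ⟨ι, U, hU, fun i => hT.hasSection_frame_assoc (hs i)⟩

theorem SpaceOver.IsBundle.isPrincipal_frame {E : SpaceOver.{u, w} B} (hE : E.IsBundle F) :
    (E.frame F).IsPrincipal :=
  E.isTorsor_frame.isPrincipal_iff.2 (E.isBundle_iff.1 hE)

theorem SpaceOver.IsDNumerable.frame {E : SpaceOver.{u, w} B} (hE : E.IsDNumerable F) :
    (E.frame F).IsDNumerable :=
  E.isTorsor_frame.isDNumerable_iff.2 (E.isDNumerable_iff.1 hE)

/-! ### Passage to isomorphism classes -/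

variable (F B)

theorem mapsTo_assoc : Set.MapsTo (assoc F) (Prin.{u, v} (Diff F) B) (Bun.{u, v} F B) := by
  rintro _ ⟨P, hP, rfl⟩
  exact ⟨P.assoc F, hP.isBundle_assoc, rfl⟩

theorem mapsTo_assoc_dNumerable :
    Set.MapsTo (assoc F) (PrinD.{u, v} (Diff F) B) (BunD.{u, v} F B) := by
  rintro _ ⟨P, hP, hD, rfl⟩
  exact ⟨P.assoc F, hP.isBundle_assoc, hP.isTorsor.isDNumerable_assoc hD, rfl⟩

theorem mapsTo_frame : Set.MapsTo (frame F) (Bun.{u, v} F B) (Prin.{u, v} (Diff F) B) := by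
  rintro _ ⟨E, hE, rfl⟩
  exact ⟨E.frame F, hE.isPrincipal_frame, rfl⟩

theorem mapsTo_frame_dNumerable :
    Set.MapsTo (frame F) (BunD.{u, v} F B) (PrinD.{u, v} (Diff F) B) := by
  rintro _ ⟨E, hE, hD, rfl⟩
  exact ⟨E.frame F, hE.isPrincipal_frame, hD.frame, rfl⟩

theorem invOn_frame_assoc :
    Set.InvOn (frame F) (assoc F) (Prin.{u, v} (Diff F) B) (Bun.{u, v} F B) := by
  constructor
  · rintro _ ⟨P, hP, rfl⟩
    have h := hP.isTorsor.iso_frame_assoc (hP.isTorsor.isPrincipal_iff.1 hP)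
    exact Quotient.sound ((GSpaceOver.iso_equivalence _ B).symm h)
  · rintro _ ⟨E, hE, rfl⟩
    exact Quotient.sound (SpaceOver.assoc_frame_iso (E.isBundle_iff.1 hE))

theorem prinD_subset_prin (G : Type v) [Group G] [DiffeologicalSpace G] [DiffeologicalGroup G] :
    PrinD.{u, v} G B ⊆ Prin.{u, v} G B := by
  rintro _ ⟨P, hP, -, rfl⟩
  exact ⟨P, hP, rfl⟩

theorem bunD_subset_bun : BunD.{u, v} F B ⊆ Bun.{u, v} F B := by
  rintro _ ⟨E, hE, -, rfl⟩
  exact ⟨E, hE, rfl⟩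

end DiffeologicalBundles

theorem mainTheorem7 (F : Type v) [DiffeologicalSpace F] :
    -- for every base, `assoc` is a bijection with inverse `frame`, also on `D`-numerable bundles
    (∀ (B : Type u) [DiffeologicalSpace B],
      Set.BijOn (assoc F)
        (Prin.{u, v} (Diff F) B)
        (Bun.{u, v} F B) ∧
      Set.InvOn (frame F) (assoc F)
        (Prin.{u, v} (Diff F) B)
        (Bun.{u, v} F B) ∧
      Set.MapsTo (frame F)
        (Bun.{u, v} F B)
        (Prin.{u, v} (Diff F) B) ∧
      Set.BijOn (assoc F)
        (PrinD.{u, v} (Diff F) B)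
        (BunD.{u, v} F B) ∧
      Set.MapsTo (frame F)
        (BunD.{u, v} F B)
        (PrinD.{u, v} (Diff F) B)) ∧
    -- pullback along smooth maps preserves all four sets, and `assoc` commutes with it
    (∀ (B B' : Type u) [DiffeologicalSpace B] [DiffeologicalSpace B'] (f : B' → B),
      DSmooth f →
      Set.MapsTo (GSpaceOverClass.pullback f)
        (Prin.{u, v} (Diff F) B)
        (Prin.{u, v} (Diff F) B') ∧
      Set.MapsTo (SpaceOverClass.pullback f)
        (Bun.{u, v} F B) (Bun.{u, v} F B') ∧
      Set.MapsTo (GSpaceOverClass.pullback f)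
        (PrinD.{u, v} (Diff F) B)
        (PrinD.{u, v} (Diff F) B') ∧
      Set.MapsTo (SpaceOverClass.pullback f)
        (BunD.{u, v} F B) (BunD.{u, v} F B') ∧
      ∀ c ∈ Prin.{u, v} (Diff F) B,
        assoc F (GSpaceOverClass.pullback f c) =
          SpaceOverClass.pullback f (assoc F c)) := by
  refine ⟨fun B _ => ?_, fun B B' _ _ f hf => ⟨?_, ?_, ?_, ?_, ?_⟩⟩
  · have hI := invOn_frame_assoc F B
    -- On `D`-numerable classes the same inverse identities are restricted; only the two inclusions
    -- of images are new.
    exact ⟨hI.bijOn (mapsTo_assoc F B) (mapsTo_frame F B), hI, mapsTo_frame F B,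
      (hI.mono (prinD_subset_prin B (Diff F)) (bunD_subset_bun F B)).bijOn
        (mapsTo_assoc_dNumerable F B) (mapsTo_frame_dNumerable F B), mapsTo_frame_dNumerable F B⟩
  · rintro _ ⟨P, hP, rfl⟩
    exact ⟨P.pullback f, hP.pullback hf, rfl⟩
  · rintro _ ⟨E, hE, rfl⟩
    exact ⟨E.pullback f, hE.pullback hf, rfl⟩
  · rintro _ ⟨P, hP, hD, rfl⟩
    exact ⟨P.pullback f, hP.pullback hf, hP.isTorsor.isDNumerable_pullback hD hf, rfl⟩
  · rintro _ ⟨E, hE, hD, rfl⟩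
    exact ⟨E.pullback f, hE.pullback hf, hD.pullback hf, rfl⟩
  · rintro _ ⟨P, hP, rfl⟩
    exact Quotient.sound (P.assoc_pullback_iso f)
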